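/- All graphs are finite and simple. A geodesic of a graph is a shortest path between two of its vertices; it is maximal if it is not a subpath of another geodesic. Let $\mathrm{gt}(G)$ be the minimum cardinality of a set of vertices of $G$ that meets every maximal geodesic of $G$, and let $\mathrm{gpack}(G)$ be the maximum cardinality of a set of mutually vertex-disjoint maximal geodesics of $G$. For $r\ge 1$ let the $r$-layer hexagonal carbon nanosheet $G$ be the subgraph of the hexagonal lattice formed by a central hexagon $C$ and the $r-1$ layers of hexagons around it. For a matching $M$ of $G$, let $G_M$ be the graph obtained from $G$ by attaching one leaf to each vertex covered by $M$ and two leaves to each other vertex. A silicate sheet is a graph whose vertices are silicon and oxygen atoms, in which every edge joins a silicon and an oxygen atom, every silicon atom has degree $4$, every oxygen atom has degree $1$ or $2$, two silicon atoms have at most one common oxygen neighbour, and every silicon atom shares an oxygen atom with at most three others. For such a graph $H$, let $\mathrm{SM}(H)$ be the graph obtained by smoothing all vertices of degree $2$ (each such vertex is removed and its two neighbours are joined by an edge). $H$ is an $r$-layer hexagonal silicate sheet if deleting all pendant vertices of $\mathrm{SM}(H)$ gives a graph isomorphic to $G$. **Theorem.** Let $r\ge 1$, let $G$ be the $r$-layer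 hexagonal carbon nanosheet with central hexagon $C$, and let $M$ be the set of edges $xy$ of $G$ such that $d(x,C)=2k$ and $d(y,C)=2k+1$ for some $k\in\{0,1,\dots,r-1\}$. Let $H$ be an $r$-layer hexagonal silicate sheet. Then $$\mathrm{gpack}(H)=\mathrm{gt}(H).$$ Moreover, $M$ is a matching of $G$, $\mathrm{SM}(H)$ is isomorphic to $G_M$, $|V(G)|=6r^2$, $|M|=3(r^2-r)$, and $$\mathrm{gt}(H)=|V(G)|-|M|=6r^2-3(r^2-r)=3(r^2+r).$$ -/

import Mathlib

/-! ### Geodesics, geodesic transversals and geodesic packings -/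

namespace SimpleGraph

variable {V : Type*}

/-- A geodesic of `G`, regarded as a subgraph: the subgraph traced by a walk from some `u` to some
`v` whose length is the distance of `u` and `v` (such a walk is automatically a path). -/
def IsGeodesic (G : SimpleGraph V) (P : G.Subgraph) : Prop :=
  ∃ (u v : V) (p : G.Walk u v), p.length = G.dist u v ∧ p.toSubgraph = P

/-- A maximal geodesic: a geodesic that is not a subpath of another geodesic. -/
def IsMaximalGeodesic (G : SimpleGraph V) (P : G.Subgraph) : Prop :=
  Maximal G.IsGeodesic P

/-- A geodesic transversal: a set of vertices that meets every maximal geodesic. -/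
def IsGeodesicTransversal (G : SimpleGraph V) (S : Set V) : Prop :=
  ∀ P : G.Subgraph, G.IsMaximalGeodesic P → ∃ x ∈ S, x ∈ P.verts

/-- The geodesic transversal number of a finite graph: the minimum cardinality of a geodesic
transversal. -/
noncomputable def gt [Finite V] (G : SimpleGraph V) : ℕ :=
  sInf {n | ∃ S : Set V, G.IsGeodesicTransversal S ∧ S.ncard = n}

/-- A geodesic packing: a set of mutually vertex-disjoint maximal geodesics. -/
def IsGeodesicPacking (G : SimpleGraph V) (F : Set G.Subgraph) : Prop :=
  (∀ P ∈ F, G.IsMaximalGeodesic P) ∧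
    ∀ P ∈ F, ∀ Q ∈ F, P ≠ Q → Disjoint P.verts Q.verts

/-- The geodesic packing number of a finite graph: the maximum cardinality of a geodesic
packing. -/
noncomputable def gpack [Finite V] (G : SimpleGraph V) : ℕ :=
  sSup {n | ∃ F : Set G.Subgraph, G.IsGeodesicPacking F ∧ F.ncard = n}

/-! ### Attaching leaves, smoothing, deleting pendant vertices -/

/-- The graph `G_M`: one leaf is attached to each vertex covered by `M`, and two leaves are attached
to every other vertex. The leaves at `v` are the pairs `(v, i)`, where `i` is restricted to `0` if
`v` is covered by `M`. -/
def attachLeaves (G : SimpleGraph V) (M : G.Subgraph) :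
    SimpleGraph (V ⊕ {l : V × Fin 2 // l.1 ∈ M.verts → l.2 = 0}) where
  Adj
    | .inl u, .inl v => G.Adj u v
    | .inl u, .inr l => l.1.1 = u
    | .inr l, .inl u => l.1.1 = u
    | .inr _, .inr _ => False
  symm := ⟨by
    rintro (u | l) (v | m) h
    · exact G.adj_symm h
    · exact h
    · exact h
    · exact h⟩
  loopless := ⟨by
    rintro (u | l) h
    · exact G.irrefl h
    · exact h⟩

/-- The graph `SM(G)` obtained by smoothing all vertices of degree `2`: the vertices of degree `2`
are removed, and two distinct remaining vertices are adjacent when they are joined in `G` by a path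
all of whose interior vertices have degree `2`. -/
def smooth (G : SimpleGraph V) : SimpleGraph {v : V // (G.neighborSet v).ncard ≠ 2} where
  Adj x y := x ≠ y ∧ ∃ p : G.Walk x y, p.IsPath ∧
    ∀ v ∈ p.support, v ≠ x → v ≠ y → (G.neighborSet v).ncard = 2
  symm := ⟨by
    rintro x y ⟨hne, p, hp, h⟩
    refine ⟨hne.symm, p.reverse, hp.reverse, fun v hv hy hx => h v ?_ hx hy⟩
    simpa using hv⟩
  loopless := ⟨fun _ h => h.1 rfl⟩

/-- The graph obtained by deleting all pendant vertices (vertices of degree `1`). -/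
def deletePendants (G : SimpleGraph V) : SimpleGraph {v : V // (G.neighborSet v).ncard ≠ 1} :=
  G.comap Subtype.val

/-- The distance of the vertex `x` from the set `C` of vertices. -/
noncomputable def distToSet (G : SimpleGraph V) (x : V) (C : Set V) : ℕ :=
  sInf (G.dist x '' C)

end SimpleGraph

/-! ### Hexagonal carbon nanosheets

The hexagonal lattice is drawn in the usual cube coordinates: the centres of the hexagons are the
points `c ∈ ℤ³` with coordinate sum `0`, and the six corners of the hexagon with centre `c` are the
points `c + e` with `e ∈ {0,1}³`, `e ≠ (0,0,0)` and `e ≠ (1,1,1)`. Two corners of a hexagon are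
joined by one of its sides if they differ by `1` in exactly one coordinate. -/

/-- `c` is the centre of a hexagon that is the central hexagon (centre `0`) or lies in one of the
`r - 1` layers around it. The hexagons of the `k`-th layer around the central one are those whose
centre has coordinates with largest absolute value `k`. -/
def IsSheetCentre (r : ℕ) (c : Fin 3 → ℤ) : Prop :=
  ∑ i, c i = 0 ∧ ∀ i, |c i| < (r : ℤ)

/-- `v` is a corner of the hexagon with centre `c` (where the coordinate sum of `c` is `0`). -/
def IsHexagonCorner (c v : Fin 3 → ℤ) : Prop :=
  (∀ i, v i - c i = 0 ∨ v i - c i = 1) ∧ (∑ i, v i = 1 ∨ ∑ i, v i = 2)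

/-- The vertices of the `r`-layer hexagonal carbon nanosheet: the corners of its hexagons. -/
def NanosheetVertex (r : ℕ) : Type :=
  {v : Fin 3 → ℤ // ∃ c, IsSheetCentre r c ∧ IsHexagonCorner c v}

/-- The `r`-layer hexagonal carbon nanosheet: the union of the central hexagon and of the hexagons
in the `r - 1` layers around it. -/
def nanosheet (r : ℕ) : SimpleGraph (NanosheetVertex r) where
  Adj u v := ∑ i, |u.1 i - v.1 i| = 1 ∧
    ∃ c, IsSheetCentre r c ∧ IsHexagonCorner c u.1 ∧ IsHexagonCorner c v.1
  symm := ⟨by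
    rintro u v ⟨h, c, hc, hu, hv⟩
    refine ⟨?_, c, hc, hv, hu⟩
    simpa only [abs_sub_comm] using h⟩
  loopless := ⟨by
    rintro u ⟨h, -⟩
    simp at h⟩

/-- The vertex set of the central hexagon `C`. -/
def centralHexagon (r : ℕ) : Set (NanosheetVertex r) :=
  {v | IsHexagonCorner 0 v.1}

/-- `x` is at distance `2k` and `y` is at distance `2k + 1` from the central hexagon, for some
`k ∈ {0, …, r - 1}`. -/
def IsLayerStep (r : ℕ) (x y : NanosheetVertex r) : Prop :=
  ∃ k < r, (nanosheet r).distToSet x (centralHexagon r) = 2 * k ∧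
    (nanosheet r).distToSet y (centralHexagon r) = 2 * k + 1

/-- The layered matching `M` of the nanosheet: the edges `xy` such that, for some
`k ∈ {0, …, r - 1}`, `x` is at distance `2k` and `y` at distance `2k + 1` from the central hexagon,
together with their end-vertices. -/
def layeredMatching (r : ℕ) : (nanosheet r).Subgraph where
  verts := {x | ∃ y, (nanosheet r).Adj x y ∧ (IsLayerStep r x y ∨ IsLayerStep r y x)}
  Adj x y := (nanosheet r).Adj x y ∧ (IsLayerStep r x y ∨ IsLayerStep r y x)
  adj_sub h := h.1
  edge_vert h := ⟨_, h⟩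
  symm := ⟨fun _ _ h => ⟨h.1.symm, h.2.symm⟩⟩

/-! ### Silicate sheets -/

/-- `H` is a silicate sheet: its vertices are silicon atoms (the set `Si`) and oxygen atoms (all
others), every edge is a bond between a silicon and an oxygen atom, each silicon atom has exactly
four bonds, each oxygen atom belongs to some tetrahedron and has at most two bonds, two tetrahedra
share at most one oxygen atom, and each tetrahedron is linked to at most three others. -/
def IsSilicateSheet {V : Type*} (H : SimpleGraph V) : Prop :=
  ∃ Si : Set V,
    (∀ u v, H.Adj u v → (u ∈ Si ↔ v ∉ Si)) ∧
    (∀ s ∈ Si, (H.neighborSet s).ncard = 4) ∧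
    (∀ o ∉ Si, 1 ≤ (H.neighborSet o).ncard ∧ (H.neighborSet o).ncard ≤ 2) ∧
    (∀ s ∈ Si, ∀ t ∈ Si, s ≠ t → (H.commonNeighbors s t).Subsingleton) ∧
    (∀ s ∈ Si, {t ∈ Si | t ≠ s ∧ (H.commonNeighbors s t).Nonempty}.ncard ≤ 3)

/-- `H` is an `r`-layer hexagonal silicate sheet: a silicate sheet such that smoothing all its
vertices of degree `2` and then deleting all pendant vertices of the result gives the `r`-layer
hexagonal carbon nanosheet. -/
def IsHexagonalSilicateSheet {V : Type*} (r : ℕ) (H : SimpleGraph V) : Prop :=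
  IsSilicateSheet H ∧ Nonempty (H.smooth.deletePendants ≃g nanosheet r)

/-!
A silicon atom with `d` neighbours in the graph `G` of the silicon atoms has `4 - d` pendant oxygen
atoms. A maximal geodesic of `H` cannot be prolonged at its ends, so it passes through two adjacent
silicon atoms, or it joins two pendant oxygen atoms of a single one. Hence every vertex cover of `G`
that contains all silicon atoms with two pendant oxygen atoms is a transversal. Conversely, an edge
of `G` whose ends have pendant oxygen atoms gives a maximal geodesic of length `4`, and a silicon
atom with two pendant oxygen atoms gives one of length `2`. A vertex cover `S` such that every edge
of `M` has exactly one end in `S` and `M` covers all vertices outside `S` thus yields a transversal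
and a packing of the same size, and by weak duality both are optimal.

In cube coordinates the distance in the nanosheet is the `ℓ¹` distance, and the distance of `v` from
the central hexagon is its level, the sum of the distances of its coordinates from `{0, 1}`. Since
the coordinate sum is `1` or `2`, exactly one coordinate of `v`, its apex, has the opposite sign to
the other two (`0` counting as negative). The edges of `M` are those in which the apex changes, all
other lattice edges at a vertex of the sheet stay in the sheet, and the vertices of even level form
the cover `S`.
-/

open SimpleGraph

section Geodesics

variable {V : Type*} {G : SimpleGraph V} {u v w : V}

theorem isGeodesic_toSubgraph (p : G.Walk u v) (hp : p.length = G.dist u v) :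
    G.IsGeodesic p.toSubgraph :=
  ⟨u, v, p, hp, rfl⟩

theorem verts_nonempty_of_isGeodesic {P : G.Subgraph} (hP : G.IsGeodesic P) : P.verts.Nonempty := by
  obtain ⟨u, v, p, -, rfl⟩ := hP
  exact ⟨u, p.start_mem_verts_toSubgraph⟩

theorem dist_ne_length_add_one_of_isMaximalGeodesic {p : G.Walk u v}
    (hp : G.IsMaximalGeodesic p.toSubgraph) (h : G.Adj v w) : G.dist u w ≠ p.length + 1 := by
  classical
  intro hd
  have hext : G.IsGeodesic (p.concat h).toSubgraph := isGeodesic_toSubgraph _ (by simp [hd])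
  have hle : p.toSubgraph ≤ (p.concat h).toSubgraph := by
    rw [Walk.concat_eq_append, Walk.toSubgraph_append]
    exact le_sup_left
  have hw : w ∈ p.support :=
    p.mem_verts_toSubgraph.1 ((hp.2 hext hle).1 (Walk.end_mem_verts_toSubgraph _))
  have h₁ := dist_le (p.takeUntil w hw)
  have h₂ := p.length_takeUntil_le_length hw
  omega

theorem eq_start_or_end_of_ncard_neighborSet_eq_one {p : G.Walk u v} (hp : p.IsPath)
    (hw : w ∈ p.support) (h1 : (G.neighborSet w).ncard = 1) : w = u ∨ w = v := by
  obtain ⟨i, rfl, hi⟩ := Walk.mem_support_iff_exists_getVert.1 hw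
  by_contra! hne
  have hpos : i ≠ 0 := fun h => hne.1 (by simp [h])
  have hlt : i < p.length := lt_of_le_of_ne hi fun h => hne.2 (by simp [h])
  have hinternal := hp.ncard_neighborSet_toSubgraph_internal_eq_two hpos hlt
  have hle := Set.ncard_le_ncard (p.toSubgraph.neighborSet_subset (p.getVert i))
    (Set.finite_of_ncard_ne_zero (by omega))
  omega

theorem toSubgraph_le_of_le_of_length_le {a b : V} {p : G.Walk u v} {q : G.Walk a b}
    (hp : p.IsPath) (hle : p.toSubgraph ≤ q.toSubgraph) (hlen : q.length ≤ p.length) :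
    q.toSubgraph ≤ p.toSubgraph := by
  have hsupport : p.support ⊆ q.support := fun x hx =>
    q.mem_verts_toSubgraph.1 (hle.1 (p.mem_verts_toSubgraph.2 hx))
  have hedges : p.edges ⊆ q.edges := fun e he =>
    q.mem_edges_toSubgraph.1 (Subgraph.edgeSet_mono hle (p.mem_edges_toSubgraph.2 he))
  have hsupport' := (List.subperm_of_subset hp.support_nodup hsupport).perm_of_length_le
    (by simpa using hlen)
  have hedges' := (List.subperm_of_subset hp.edges_nodup hedges).perm_of_length_le
    (by simpa using hlen)
  refine ⟨fun x hx => ?_, fun x y hxy => ?_⟩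
  · rw [Walk.mem_verts_toSubgraph] at hx ⊢
    exact hsupport'.mem_iff.2 hx
  · rw [Walk.adj_toSubgraph_iff_mem_edges] at hxy ⊢
    exact hedges'.mem_iff.2 hxy

theorem isMaximalGeodesic_of_ncard_neighborSet_eq_one (p : G.Walk u v)
    (hp : p.length = G.dist u v) (huv : u ≠ v) (hu : (G.neighborSet u).ncard = 1)
    (hv : (G.neighborSet v).ncard = 1) : G.IsMaximalGeodesic p.toSubgraph := by
  refine ⟨isGeodesic_toSubgraph p hp, ?_⟩
  rintro _ ⟨a, b, q, hq, rfl⟩ hle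
  have hend {x : V} (hx : x ∈ p.toSubgraph.verts) (h1 : (G.neighborSet x).ncard = 1) :
      x = a ∨ x = b :=
    eq_start_or_end_of_ncard_neighborSet_eq_one (q.isPath_of_length_eq_dist hq)
      (q.mem_verts_toSubgraph.1 (hle.1 hx)) h1
  refine toSubgraph_le_of_le_of_length_le (p.isPath_of_length_eq_dist hp) hle ?_
  rw [hp, hq]
  rcases hend p.start_mem_verts_toSubgraph hu with rfl | rfl <;>
    rcases hend p.end_mem_verts_toSubgraph hv with rfl | rfl
  · exact absurd rfl huv
  · rfl
  · exact dist_comm.le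
  · exact absurd rfl huv

theorem ncard_le_of_isGeodesicPacking_of_isGeodesicTransversal [Finite V] {F : Set G.Subgraph}
    {S : Set V} (hF : G.IsGeodesicPacking F) (hS : G.IsGeodesicTransversal S) :
    F.ncard ≤ S.ncard := by
  obtain rfl | ⟨P₀, hP₀⟩ := F.eq_empty_or_nonempty
  · simp
  have : Nonempty V := (verts_nonempty_of_isGeodesic (hF.1 P₀ hP₀).1).to_type
  choose! f hfS hf using fun P (hP : P ∈ F) => hS P (hF.1 P hP)
  refine Set.ncard_le_ncard_of_injOn f hfS (fun P hP Q hQ hPQ => ?_) S.toFinite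
  by_contra hne
  exact Set.disjoint_left.1 (hF.2 P hP Q hQ hne) (hf P hP) (hPQ ▸ hf Q hQ)

theorem gpack_eq_and_gt_eq_of_ncard_eq [Finite V] {F : Set G.Subgraph} {S : Set V}
    (hF : G.IsGeodesicPacking F) (hS : G.IsGeodesicTransversal S) (h : F.ncard = S.ncard) :
    G.gpack = S.ncard ∧ G.gt = S.ncard := by
  constructor
  · refine IsGreatest.csSup_eq ⟨⟨F, hF, h⟩, ?_⟩
    rintro _ ⟨F', hF', rfl⟩
    exact ncard_le_of_isGeodesicPacking_of_isGeodesicTransversal hF' hS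
  · refine IsLeast.csInf_eq ⟨⟨S, hS, rfl⟩, ?_⟩
    rintro _ ⟨S', hS', rfl⟩
    exact h ▸ ncard_le_of_isGeodesicPacking_of_isGeodesicTransversal hF hS'

theorem exists_isGeodesicPacking_ncard_eq {ι : Type*} {P : ι → G.Subgraph}
    (hP : ∀ i, G.IsMaximalGeodesic (P i))
    (hdisj : Pairwise fun i j => Disjoint (P i).verts (P j).verts) :
    ∃ F : Set G.Subgraph, G.IsGeodesicPacking F ∧ F.ncard = Nat.card ι := by
  have hinj : P.Injective := fun i j hij => by
    by_contra hne
    obtain ⟨x, hx⟩ := verts_nonempty_of_isGeodesic (hP i).1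
    exact Set.disjoint_left.1 (hdisj hne) hx (hij ▸ hx)
  refine ⟨Set.range P, ⟨?_, ?_⟩, Set.ncard_range_of_injective hinj⟩
  · rintro _ ⟨i, rfl⟩
    exact hP i
  · rintro _ ⟨i, rfl⟩ _ ⟨j, rfl⟩ hne
    exact hdisj fun hij => hne (hij ▸ rfl)

end Geodesics

section Leaves

variable {V W : Type*} {K : SimpleGraph V} {G : SimpleGraph W}

/-- The leaves attached to `v`: its neighbours of degree `1`. -/
def leavesAt (K : SimpleGraph V) (v : V) : Set V :=
  {o | K.Adj v o ∧ (K.neighborSet o).ncard = 1}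

theorem eq_of_adj_of_ncard_neighborSet_eq_one {o s t : V} (ho : (K.neighborSet o).ncard = 1)
    (hs : K.Adj o s) (ht : K.Adj o t) : s = t := by
  obtain ⟨a, ha⟩ := Set.ncard_eq_one.1 ho
  have hmem {x : V} (hx : x ∈ K.neighborSet o) : x = a := by rwa [ha] at hx
  rw [hmem hs, hmem ht]

theorem ncard_leavesAt_add_ncard_neighborSet_deletePendants {v : V}
    (hfin : (K.neighborSet v).Finite) (hv : (K.neighborSet v).ncard ≠ 1) :
    (leavesAt K v).ncard + (K.deletePendants.neighborSet ⟨v, hv⟩).ncard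
      = (K.neighborSet v).ncard := by
  have hsub : leavesAt K v ⊆ K.neighborSet v := fun o ho => ho.1
  rw [← Set.ncard_sdiff_add_ncard_of_subset hsub hfin, add_comm,
    ← Set.ncard_image_of_injective _ Subtype.val_injective]
  congr 2
  ext o
  simp only [leavesAt, deletePendants, Set.mem_image, mem_neighborSet, comap_adj, Subtype.exists,
    exists_and_left, exists_prop, exists_eq_right_right, Set.mem_sdiff, Set.mem_ofPred_eq, not_and]
  tauto

variable {φ : G ≃g K.deletePendants} {M : G.Subgraph}

theorem exists_leaf_labelling
    (hpendant : ∀ v w, (K.neighborSet v).ncard = 1 → K.Adj v w → (K.neighborSet w).ncard ≠ 1)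
    (hcovered : ∀ x ∈ M.verts, (leavesAt K (φ x)).ncard = 1)
    (huncovered : ∀ x ∉ M.verts, (leavesAt K (φ x)).ncard = 2) :
    ∃ g : {l : W × Fin 2 // l.1 ∈ M.verts → l.2 = 0} → V,
      g.Injective ∧ Set.range g = {o | (K.neighborSet o).ncard = 1} ∧
        ∀ l, K.Adj (φ l.1.1) (g l) := by
  have hequiv (x : W) : Nonempty ({i : Fin 2 // x ∈ M.verts → i = 0} ≃ leavesAt K (φ x)) := by
    have hcard : Nat.card {i : Fin 2 // x ∈ M.verts → i = 0} = (leavesAt K (φ x)).ncard := by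
      by_cases hx : x ∈ M.verts
      · simp [hx, hcovered x hx]
      · simp [hx, huncovered x hx]
    have : Finite (leavesAt K (φ x)) :=
      Set.finite_of_ncard_pos (hcard ▸ @Nat.card_pos _ ⟨0, fun _ => rfl⟩ _)
    exact Finite.card_eq.1 hcard
  let e (x : W) : {i : Fin 2 // x ∈ M.verts → i = 0} ≃ leavesAt K (φ x) := (hequiv x).some
  refine ⟨fun l => e l.1.1 ⟨l.1.2, l.2⟩, ?_, ?_, fun l => (e l.1.1 ⟨l.1.2, l.2⟩).2.1⟩
  · rintro ⟨⟨x, i⟩, hi⟩ ⟨⟨y, j⟩, hj⟩ heq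
    obtain ⟨hx, hleaf⟩ := (e x ⟨i, hi⟩).2
    have hy : K.Adj (φ y) (e x ⟨i, hi⟩) := by
      have := (e y ⟨j, hj⟩).2.1
      rwa [← show ((e x ⟨i, hi⟩ : V)) = e y ⟨j, hj⟩ from heq] at this
    obtain rfl : x = y := φ.injective <| Subtype.ext <|
      eq_of_adj_of_ncard_neighborSet_eq_one hleaf hx.symm hy.symm
    have := (e x).injective (Subtype.ext heq)
    simpa using this
  · ext o
    refine ⟨?_, fun ho => ?_⟩
    · rintro ⟨l, rfl⟩
      exact (e l.1.1 ⟨l.1.2, l.2⟩).2.2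
    · obtain ⟨w, hw⟩ := Set.nonempty_of_ncard_ne_zero (s := K.neighborSet o) (by rw [ho]; norm_num)
      obtain ⟨x, hx⟩ := φ.surjective ⟨w, hpendant o w ho hw⟩
      have hleaf : o ∈ leavesAt K (φ x) := ⟨hx ▸ hw.symm, ho⟩
      obtain ⟨i, hi⟩ := (e x).surjective ⟨o, hleaf⟩
      exact ⟨⟨⟨x, i⟩, i.2⟩, congrArg Subtype.val hi⟩

theorem nonempty_iso_attachLeaves
    (hpendant : ∀ v w, (K.neighborSet v).ncard = 1 → K.Adj v w → (K.neighborSet w).ncard ≠ 1)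
    (hcovered : ∀ x ∈ M.verts, (leavesAt K (φ x)).ncard = 1)
    (huncovered : ∀ x ∉ M.verts, (leavesAt K (φ x)).ncard = 2) :
    Nonempty (K ≃g G.attachLeaves M) := by
  obtain ⟨g, hinj, hrange, hadj⟩ := exists_leaf_labelling hpendant hcovered huncovered
  have hpend (l) : (K.neighborSet (g l)).ncard = 1 := (Set.ext_iff.1 hrange (g l)).1 ⟨l, rfl⟩
  have hadj_iff (x l) : K.Adj (φ x) (g l) ↔ l.1.1 = x := by
    refine ⟨fun h => φ.injective <| Subtype.ext <|
      eq_of_adj_of_ncard_neighborSet_eq_one (hpend l) (hadj l).symm h.symm, ?_⟩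
    rintro rfl
    exact hadj l
  let f := Sum.elim (fun x => (φ x : V)) g
  have hf : f.Bijective := by
    refine ⟨(Subtype.val_injective.comp φ.injective).sumElim hinj
      fun x l hxl => (φ x).2 ?_, fun v => ?_⟩
    · exact (congrArg (fun v => (K.neighborSet v).ncard) hxl).trans (hpend l)
    by_cases hv : (K.neighborSet v).ncard = 1
    · obtain ⟨l, hl⟩ := (Set.ext_iff.1 hrange v).2 hv
      exact ⟨.inr l, hl⟩
    · obtain ⟨x, hx⟩ := φ.surjective ⟨v, hv⟩
      exact ⟨.inl x, congrArg Subtype.val hx⟩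
  refine ⟨RelIso.symm ⟨Equiv.ofBijective f hf, ?_⟩⟩
  rintro (x | l) (y | m)
  · exact φ.map_adj_iff
  · exact hadj_iff x m
  · exact K.adj_comm _ _ |>.trans (hadj_iff y l)
  · exact iff_of_false (fun h => hpendant _ _ (hpend l) h (hpend m)) id

end Leaves

section KonigCovers

variable {W : Type*} {G : SimpleGraph W} {M : G.Subgraph} {S : Set W}

/-- The vertex cover `S` and the matching `M` certify each other in the sense of König's theorem:
each edge of `M` has exactly one end in `S`, and `M` covers all vertices outside `S`. Unlike in
König's theorem, `S` may have members that `M` does not cover. -/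
structure IsKonigCover (M : G.Subgraph) (S : Set W) : Prop where
  isMatching : M.IsMatching
  isVertexCover : G.IsVertexCover S
  notMem_of_adj : ∀ {x y}, M.Adj x y → x ∈ S → y ∉ S
  mem_verts : ∀ {x}, x ∉ S → x ∈ M.verts

namespace IsKonigCover

/-- The vertex `x` of the cover `S` together with its partner under `M`, if there is one. -/
def block (M : G.Subgraph) (S : Set W) (x : W) : Set W :=
  {y | y = x ∨ y ∉ S ∧ M.Adj x y}

theorem disjoint_block (h : IsKonigCover M S) {x y : W} (hx : x ∈ S) (hy : y ∈ S) (hxy : x ≠ y) :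
    Disjoint (block M S x) (block M S y) := by
  refine Set.disjoint_left.2 ?_
  rintro z (rfl | ⟨hz, hxz⟩) (rfl | ⟨hz', hyz⟩)
  · exact hxy rfl
  · exact hz' hx
  · exact hz hy
  · exact hxy (h.isMatching.eq_of_adj_right hxz hyz)

theorem ncard_add_ncard_edgeSet [Finite W] (h : IsKonigCover M S) :
    S.ncard + M.edgeSet.ncard = Nat.card W := by
  rw [← Set.ncard_add_ncard_compl S, add_right_inj, eq_comm]
  choose! partner hpartner using fun x (hx : x ∈ Sᶜ) => (h.isMatching (h.mem_verts hx)).exists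
  refine Set.ncard_congr (fun x _ => s(x, partner x)) hpartner (fun x y hx hy heq => ?_) ?_
  · rcases Sym2.eq_iff.1 heq with ⟨hxy, -⟩ | ⟨hxy, -⟩
    · exact hxy
    · exact absurd (h.isVertexCover (hxy ▸ (hpartner y hy).adj_sub)) (by tauto)
  · have hsurj {x y : W} (hx : x ∉ S) (hxy : M.Adj x y) :
        ∃ z, ∃ _ : z ∈ Sᶜ, s(z, partner z) = s(x, y) :=
      ⟨x, hx, by rw [h.isMatching.eq_of_adj_left (hpartner x hx) hxy]⟩
    rintro ⟨x, y⟩ hxy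
    by_cases hx : x ∈ S
    · have := hsurj (h.notMem_of_adj hxy hx) hxy.symm
      rwa [Sym2.eq_swap] at this
    · exact hsurj hx hxy

end IsKonigCover

end KonigCovers

section Silicates

variable {V W : Type*} {H : SimpleGraph V} {Si : Set V}

/-- `Si` is the set of silicon atoms of a silicate `H`, in which the number of tetrahedra linked to
a given one is not restricted. -/
structure IsSiliconSet (H : SimpleGraph V) (Si : Set V) : Prop where
  mem_iff_notMem : ∀ u v, H.Adj u v → (u ∈ Si ↔ v ∉ Si)
  ncard_eq_four : ∀ s ∈ Si, (H.neighborSet s).ncard = 4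
  one_le_ncard : ∀ o ∉ Si, 1 ≤ (H.neighborSet o).ncard
  ncard_le_two : ∀ o ∉ Si, (H.neighborSet o).ncard ≤ 2
  subsingleton_commonNeighbors : ∀ s ∈ Si, ∀ t ∈ Si, s ≠ t → (H.commonNeighbors s t).Subsingleton

theorem IsSilicateSheet.exists_isSiliconSet (hH : IsSilicateSheet H) :
    ∃ Si : Set V, IsSiliconSet H Si := by
  obtain ⟨Si, hmem, hsilicon, hoxygen, hcommon, -⟩ := hH
  exact ⟨Si, hmem, hsilicon, fun o ho => (hoxygen o ho).1, fun o ho => (hoxygen o ho).2, hcommon⟩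

/-- The graph of the silicon atoms of `H`, in which two atoms are adjacent if they share an oxygen
atom. -/
def siliconGraph (H : SimpleGraph V) (Si : Set V) : SimpleGraph Si where
  Adj s t := s ≠ t ∧ (H.commonNeighbors s t).Nonempty
  symm := ⟨fun s t h => ⟨h.1.symm, by rw [commonNeighbors_symm]; exact h.2⟩⟩
  loopless := ⟨fun _ h => h.1 rfl⟩

namespace IsSiliconSet

theorem notMem_of_adj (h : IsSiliconSet H Si) {s o : V} (hs : s ∈ Si) (hso : H.Adj s o) : o ∉ Si :=
  (h.mem_iff_notMem s o hso).1 hs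

theorem mem_of_adj (h : IsSiliconSet H Si) {o s : V} (ho : o ∉ Si) (hos : H.Adj o s) : s ∈ Si :=
  not_not.1 fun hs => ho ((h.mem_iff_notMem o s hos).2 hs)

theorem finite_neighborSet (h : IsSiliconSet H Si) (v : V) : (H.neighborSet v).Finite := by
  by_cases hv : v ∈ Si
  · exact Set.finite_of_ncard_pos (by rw [h.ncard_eq_four v hv]; norm_num)
  · exact Set.finite_of_ncard_pos (h.one_le_ncard v hv)

theorem exists_adj_ne (h : IsSiliconSet H Si) {s : V} (hs : s ∈ Si) (o : V) :
    ∃ o', H.Adj s o' ∧ o' ≠ o :=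
  Set.exists_ne_of_one_lt_ncard (s := H.neighborSet s) (by rw [h.ncard_eq_four s hs]; norm_num) o

theorem exists_adj (h : IsSiliconSet H Si) (v : V) : ∃ w, H.Adj v w := by
  by_cases hv : v ∈ Si
  · exact (h.exists_adj_ne hv v).imp fun _ hw => hw.1
  · exact (Set.ncard_pos (h.finite_neighborSet v)).1 (h.one_le_ncard v hv)

theorem exists_silicon (h : IsSiliconSet H Si) (v : V) : ∃ s : Si, ↑s = v ∨ H.Adj s v := by
  by_cases hv : v ∈ Si
  · exact ⟨⟨v, hv⟩, .inl rfl⟩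
  · obtain ⟨s, hs⟩ := h.exists_adj v
    exact ⟨⟨s, h.mem_of_adj hv hs⟩, .inr hs.symm⟩

theorem exists_adj_ne_of_notMem (h : IsSiliconSet H Si) {o : V} (ho : o ∉ Si)
    (h1 : (H.neighborSet o).ncard ≠ 1) (s : V) : ∃ t, H.Adj o t ∧ t ≠ s :=
  Set.exists_ne_of_one_lt_ncard (s := H.neighborSet o)
    (lt_of_le_of_ne (h.one_le_ncard o ho) h1.symm) s

theorem neighborSet_eq_pair (h : IsSiliconSet H Si) {o s t : V} (ho : o ∉ Si)
    (hs : H.Adj o s) (ht : H.Adj o t) (hst : s ≠ t) : H.neighborSet o = {s, t} := by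
  refine (Set.eq_of_subset_of_ncard_le ?_ ?_ (h.finite_neighborSet o)).symm
  · exact Set.insert_subset hs (Set.singleton_subset_iff.2 ht)
  · exact Set.ncard_pair hst ▸ h.ncard_le_two o ho

theorem even_dist_iff (h : IsSiliconSet H Si) {u v : V} (huv : H.Reachable u v) :
    Even (H.dist u v) ↔ (u ∈ Si ↔ v ∈ Si) := by
  classical
  obtain ⟨p, hp⟩ := huv.exists_walk_length_eq_dist
  let c : H.Coloring Bool := Coloring.mk (fun v => decide (v ∈ Si)) fun {u v} huv => by
    simp [h.mem_iff_notMem u v huv]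
  rw [← hp, c.even_length_iff_congr p]
  exact iff_congr decide_eq_true_iff decide_eq_true_iff

theorem ncard_leavesAt_add_ncard_neighborSet_siliconGraph (h : IsSiliconSet H Si) (s : Si) :
    (leavesAt H s).ncard + ((siliconGraph H Si).neighborSet s).ncard = 4 := by
  have hsub : leavesAt H (s : V) ⊆ H.neighborSet s := fun o ho => ho.1
  rw [← h.ncard_eq_four s s.2,
    ← Set.ncard_sdiff_add_ncard_of_subset hsub (h.finite_neighborSet s), add_comm, add_left_inj]
  have : Nonempty V := ⟨s⟩
  choose! f hf using fun t (ht : (siliconGraph H Si).Adj s t) => ht.2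
  have hfO {t : Si} (ht : (siliconGraph H Si).Adj s t) : f t ∉ Si := h.notMem_of_adj s.2 (hf t ht).1
  refine Set.ncard_congr (fun t _ => f t) (fun t ht => ⟨(hf t ht).1, fun hleaf => ?_⟩)
    (fun t t' ht ht' heq => ?_) (fun o ho => ?_)
  · exact ht.1 <| Subtype.ext <|
      eq_of_adj_of_ncard_neighborSet_eq_one hleaf.2 (hf t ht).1.symm (hf t ht).2.symm
  · have hmem : (t' : V) ∈ H.neighborSet (f t) := heq ▸ (hf t' ht').2.symm
    rw [h.neighborSet_eq_pair (hfO ht) (hf t ht).1.symm (hf t ht).2.symm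
      (Subtype.coe_ne_coe.2 ht.1)] at hmem
    exact (Subtype.ext (hmem.resolve_left fun he => ht'.1 (Subtype.ext he.symm))).symm
  · have hoO := h.notMem_of_adj s.2 ho.1
    obtain ⟨t, hot, hts⟩ := h.exists_adj_ne_of_notMem hoO (fun h1 => ho.2 ⟨ho.1, h1⟩) s
    have hadj : (siliconGraph H Si).Adj s ⟨t, h.mem_of_adj hoO hot⟩ :=
      ⟨fun he => hts (congrArg Subtype.val he).symm, o, ho.1, hot.symm⟩
    exact ⟨_, hadj, h.subsingleton_commonNeighbors s s.2 t (h.mem_of_adj hoO hot) hts.symm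
      (hf _ hadj) ⟨ho.1, hot.symm⟩⟩

theorem dist_eq_two (h : IsSiliconSet H Si) {s o o' : V} (hs : s ∈ Si) (ho : H.Adj s o)
    (ho' : H.Adj s o') (hne : o ≠ o') : H.dist o o' = 2 := by
  have hreach : H.Reachable o o' := ho.symm.reachable.trans ho'.reachable
  have hle : H.dist o o' ≤ 2 := dist_le (.cons ho.symm (.cons ho' .nil))
  have hpos := hreach.pos_dist_of_ne hne
  have heven := (h.even_dist_iff hreach).2
    (iff_of_false (h.notMem_of_adj hs ho) (h.notMem_of_adj hs ho'))
  grind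

theorem dist_eq_three (h : IsSiliconSet H Si) {s t o o' : V} (hs : s ∈ Si) (hst : s ≠ t)
    (ho : H.Adj s o) (hne : o ≠ o') (ho' : o' ∈ H.commonNeighbors s t) : H.dist o t = 3 := by
  have hoO := h.notMem_of_adj hs ho
  have ht := h.mem_of_adj (h.notMem_of_adj hs ho'.1) ho'.2.symm
  have hreach : H.Reachable o t :=
    ho.symm.reachable.trans (ho'.1.reachable.trans ho'.2.symm.reachable)
  have hle : H.dist o t ≤ 3 := dist_le (.cons ho.symm (.cons ho'.1 (.cons ho'.2.symm .nil)))
  have hodd : ¬ Even (H.dist o t) := by simp [h.even_dist_iff hreach, hoO, ht]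
  have hnadj : H.dist o t ≠ 1 := fun h1 =>
    hne (h.subsingleton_commonNeighbors s hs t ht hst ⟨ho, (dist_eq_one_iff_adj.1 h1).symm⟩ ho')
  grind

theorem dist_eq_four (h : IsSiliconSet H Si) {s t : Si} (hst : (siliconGraph H Si).Adj s t)
    {o o' : V} (ho : o ∈ leavesAt H s) (ho' : o' ∈ leavesAt H t) : H.dist o o' = 4 := by
  obtain ⟨m, hsm, htm⟩ := hst.2
  have hoo : ∀ w, H.Adj o w → ¬ H.Adj o' w := fun w hw hw' => hst.1 <| Subtype.ext <|
    (eq_of_adj_of_ncard_neighborSet_eq_one ho.2 ho.1.symm hw).trans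
      (eq_of_adj_of_ncard_neighborSet_eq_one ho'.2 hw' ho'.1.symm)
  let p : H.Walk o o' := .cons ho.1.symm (.cons hsm (.cons htm.symm (.cons ho'.1 .nil)))
  have hle : H.dist o o' ≤ 4 := dist_le p
  have heven := (h.even_dist_iff p.reachable).2
    (iff_of_false (h.notMem_of_adj s.2 ho.1) (h.notMem_of_adj t.2 ho'.1))
  have hpos : H.dist o o' ≠ 0 := by
    rw [Ne, p.reachable.dist_eq_zero_iff]
    rintro rfl
    exact hoo s ho.1.symm ho.1.symm
  have htwo : H.dist o o' ≠ 2 := fun h2 => by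
    obtain ⟨q, hq⟩ := p.reachable.exists_walk_length_eq_dist
    rw [h2] at hq
    match q, hq with
    | .cons hw (.cons hw' .nil), _ => exact hoo _ hw hw'.symm
  grind

theorem two_le_length_of_isMaximalGeodesic (h : IsSiliconSet H Si) {u v : V} {p : H.Walk u v}
    (hp : H.IsMaximalGeodesic p.toSubgraph) : 2 ≤ p.length := by
  have hsilicon {a b : V} {q : H.Walk a b} (hq : H.IsMaximalGeodesic q.toSubgraph) (hb : b ∈ Si) :
      q.length ≠ 1 := fun h1 => by
    obtain ⟨o, ho, hne⟩ := h.exists_adj_ne hb a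
    refine dist_ne_length_add_one_of_isMaximalGeodesic hq ho ?_
    rw [h1, h.dist_eq_two hb (Walk.adj_of_length_eq_one h1).symm ho hne.symm]
  have hzero : p.length ≠ 0 := fun h0 => by
    obtain ⟨w, hw⟩ := h.exists_adj v
    refine dist_ne_length_add_one_of_isMaximalGeodesic hp hw ?_
    rw [h0, Walk.eq_of_length_eq_zero h0, dist_eq_one_iff_adj.2 hw]
  have hone : p.length ≠ 1 := fun h1 => by
    by_cases hv : v ∈ Si
    · exact hsilicon hp hv h1
    · rw [← Walk.toSubgraph_reverse] at hp
      exact hsilicon hp (h.mem_of_adj hv (Walk.adj_of_length_eq_one h1).symm)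
        (p.length_reverse.trans h1)
  omega

theorem ncard_neighborSet_eq_one_of_isMaximalGeodesic (h : IsSiliconSet H Si) {s u v : V}
    {p : H.Walk u v} (hp : H.IsMaximalGeodesic p.toSubgraph) (hlen : p.length = 2) (hs : s ∈ Si)
    (hu : H.Adj s u) (hv : H.Adj s v) (huv : u ≠ v) : (H.neighborSet v).ncard = 1 := by
  by_contra h1
  obtain ⟨t, hvt, hts⟩ := h.exists_adj_ne_of_notMem (h.notMem_of_adj hs hv) h1 s
  refine dist_ne_length_add_one_of_isMaximalGeodesic hp hvt ?_
  rw [hlen, h.dist_eq_three hs hts.symm hu huv ⟨hv, hvt.symm⟩]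

theorem exists_adj_or_exists_nontrivial_of_isMaximalGeodesic (h : IsSiliconSet H Si)
    {P : H.Subgraph} (hP : H.IsMaximalGeodesic P) :
    (∃ s t : Si, (siliconGraph H Si).Adj s t ∧ ↑s ∈ P.verts ∧ ↑t ∈ P.verts) ∨
      ∃ s : Si, (leavesAt H s).Nontrivial ∧ ↑s ∈ P.verts := by
  obtain ⟨u, v, p, hp, rfl⟩ := hP.1
  have hpath := p.isPath_of_length_eq_dist hp
  have hlen := h.two_le_length_of_isMaximalGeodesic hP
  have hlinked {x o y : V} (hx : x ∈ Si) (hxo : H.Adj x o) (hoy : H.Adj o y) (hxy : x ≠ y) :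
      ∃ hy : y ∈ Si, (siliconGraph H Si).Adj ⟨x, hx⟩ ⟨y, hy⟩ :=
    ⟨h.mem_of_adj (h.notMem_of_adj hx hxo) hoy, by simpa using hxy, o, hxo, hoy.symm⟩
  match p with
  | .nil | .cons _ .nil => simp at hlen
  | .cons (v := x) hux (.cons (v := y) hxy q) =>
    have hne : u ≠ y := by
      rintro rfl
      simp at hpath
    by_cases hu : u ∈ Si
    · obtain ⟨hy, hadj⟩ := hlinked hu hux hxy hne
      exact .inl ⟨_, _, hadj, by simp, by simp⟩
    have hx := h.mem_of_adj hu hux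
    match q with
    | .nil =>
      have hpend_y := h.ncard_neighborSet_eq_one_of_isMaximalGeodesic hP rfl hx hux.symm hxy hne
      rw [← Walk.toSubgraph_reverse] at hP
      have hpend_u :=
        h.ncard_neighborSet_eq_one_of_isMaximalGeodesic hP rfl hx hxy hux.symm hne.symm
      exact .inr ⟨⟨x, hx⟩, ⟨u, ⟨hux.symm, hpend_u⟩, y, ⟨hxy, hpend_y⟩, hne⟩, by simp⟩
    | .cons (v := z) hyz q =>
      obtain ⟨hz, hadj⟩ := hlinked hx hxy hyz (by rintro rfl; simp at hpath)
      exact .inl ⟨_, _, hadj, by simp, by simp⟩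

theorem isGeodesicTransversal_image (h : IsSiliconSet H Si) {S : Set Si}
    (hcover : (siliconGraph H Si).IsVertexCover S)
    (hleaves : ∀ s : Si, (leavesAt H s).Nontrivial → s ∈ S) :
    H.IsGeodesicTransversal (Subtype.val '' S) := by
  intro P hP
  rcases h.exists_adj_or_exists_nontrivial_of_isMaximalGeodesic hP with
    ⟨s, t, hst, hs, ht⟩ | ⟨s, hl, hs⟩
  · rcases hcover hst with hS | hS
    · exact ⟨s, ⟨s, hS, rfl⟩, hs⟩
    · exact ⟨t, ⟨t, hS, rfl⟩, ht⟩
  · exact ⟨s, ⟨s, hleaves s hl, rfl⟩, hs⟩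

end IsSiliconSet

/-- The vertices that belong to no tetrahedron other than those of the silicon atoms in `T`. -/
def exclusiveVertices (H : SimpleGraph V) (Si : Set V) (T : Set Si) : Set V :=
  {w | ∀ s : Si, (↑s = w ∨ H.Adj s w) → s ∈ T}

theorem exclusiveVertices_mono {T T' : Set Si} (hT : T ⊆ T') :
    exclusiveVertices H Si T ⊆ exclusiveVertices H Si T' :=
  fun _ hw s hs => hT (hw s hs)

namespace IsSiliconSet

theorem disjoint_exclusiveVertices (h : IsSiliconSet H Si) {T T' : Set Si} (hT : Disjoint T T') :
    Disjoint (exclusiveVertices H Si T) (exclusiveVertices H Si T') := by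
  refine Set.disjoint_left.2 fun w hw hw' => ?_
  obtain ⟨s, hs⟩ := h.exists_silicon w
  exact Set.disjoint_left.1 hT (hw s hs) (hw' s hs)

theorem coe_mem_exclusiveVertices (h : IsSiliconSet H Si) {T : Set Si} {s : Si} (hs : s ∈ T) :
    ↑s ∈ exclusiveVertices H Si T := by
  rintro t (hts | hadj)
  · rwa [Subtype.ext hts]
  · exact absurd s.2 (h.notMem_of_adj t.2 hadj)

theorem mem_exclusiveVertices_of_mem_leavesAt (h : IsSiliconSet H Si) {T : Set Si} {s : Si}
    (hs : s ∈ T) {o : V} (ho : o ∈ leavesAt H s) : o ∈ exclusiveVertices H Si T := by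
  rintro t (rfl | hadj)
  · exact absurd t.2 (h.notMem_of_adj s.2 ho.1)
  · rwa [Subtype.ext (eq_of_adj_of_ncard_neighborSet_eq_one ho.2 hadj.symm ho.1.symm)]

theorem mem_exclusiveVertices_of_mem_commonNeighbors (h : IsSiliconSet H Si) {T : Set Si}
    {s t : Si} (hs : s ∈ T) (ht : t ∈ T) (hst : s ≠ t) {o : V} (ho : o ∈ H.commonNeighbors s t) :
    o ∈ exclusiveVertices H Si T := by
  have hoO := h.notMem_of_adj s.2 ho.1
  rintro u (rfl | hadj)
  · exact absurd u.2 hoO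
  · have hu : (u : V) ∈ H.neighborSet o := hadj.symm
    rw [h.neighborSet_eq_pair hoO ho.1.symm ho.2.symm (Subtype.coe_ne_coe.2 hst)] at hu
    rcases hu with hu | hu
    · rwa [Subtype.ext hu]
    · rwa [Subtype.ext hu]

theorem exists_isMaximalGeodesic_of_nontrivial (h : IsSiliconSet H Si) {s : Si}
    (hs : (leavesAt H s).Nontrivial) :
    ∃ P : H.Subgraph, H.IsMaximalGeodesic P ∧ P.verts ⊆ exclusiveVertices H Si {s} := by
  obtain ⟨o, ho, o', ho', hne⟩ := hs
  let p : H.Walk o o' := .cons ho.1.symm (.cons ho'.1 .nil)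
  refine ⟨p.toSubgraph, isMaximalGeodesic_of_ncard_neighborSet_eq_one p
    (h.dist_eq_two s.2 ho.1 ho'.1 hne).symm hne ho.2 ho'.2, fun w hw => ?_⟩
  simp only [p, Walk.mem_verts_toSubgraph, Walk.support_cons, Walk.support_nil, List.mem_cons,
    List.not_mem_nil, or_false] at hw
  rcases hw with rfl | rfl | rfl
  · exact h.mem_exclusiveVertices_of_mem_leavesAt (Set.mem_singleton s) ho
  · exact h.coe_mem_exclusiveVertices (Set.mem_singleton s)
  · exact h.mem_exclusiveVertices_of_mem_leavesAt (Set.mem_singleton s) ho'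

theorem exists_isMaximalGeodesic_of_adj (h : IsSiliconSet H Si) {s t : Si}
    (hst : (siliconGraph H Si).Adj s t) (hs : (leavesAt H s).Nonempty)
    (ht : (leavesAt H t).Nonempty) :
    ∃ P : H.Subgraph, H.IsMaximalGeodesic P ∧ P.verts ⊆ exclusiveVertices H Si {s, t} := by
  obtain ⟨o, ho⟩ := hs
  obtain ⟨o', ho'⟩ := ht
  obtain ⟨m, hsm, htm⟩ := hst.2
  have hdist := h.dist_eq_four hst ho ho'
  have hne : o ≠ o' := by
    rintro rfl
    simp at hdist
  let p : H.Walk o o' := .cons ho.1.symm (.cons hsm (.cons htm.symm (.cons ho'.1 .nil)))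
  refine ⟨p.toSubgraph,
    isMaximalGeodesic_of_ncard_neighborSet_eq_one p hdist.symm hne ho.2 ho'.2, fun w hw => ?_⟩
  rw [Walk.mem_verts_toSubgraph, show p.support = [o, ↑s, m, ↑t, o'] from rfl] at hw
  simp only [List.mem_cons, List.not_mem_nil, or_false] at hw
  rcases hw with rfl | rfl | rfl | rfl | rfl
  · exact h.mem_exclusiveVertices_of_mem_leavesAt (.inl rfl) ho
  · exact h.coe_mem_exclusiveVertices (.inl rfl)
  · exact h.mem_exclusiveVertices_of_mem_commonNeighbors (.inl rfl) (.inr rfl) hst.1 ⟨hsm, htm⟩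
  · exact h.coe_mem_exclusiveVertices (.inr rfl)
  · exact h.mem_exclusiveVertices_of_mem_leavesAt (.inr rfl) ho'

variable {G : SimpleGraph W} {M : G.Subgraph} {S : Set W} (φ : G ≃g siliconGraph H Si)

theorem ncard_leavesAt_add_ncard_neighborSet (h : IsSiliconSet H Si) (x : W) :
    (leavesAt H (φ x)).ncard + (G.neighborSet x).ncard = 4 := by
  rw [← h.ncard_leavesAt_add_ncard_neighborSet_siliconGraph (φ x)]
  exact congrArg _ (Nat.card_congr (φ.mapNeighborSet x))

theorem isGeodesicTransversal_of_isVertexCover (h : IsSiliconSet H Si) (hS : G.IsVertexCover S)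
    (hdeg : ∀ x ∉ S, (G.neighborSet x).ncard = 3) :
    H.IsGeodesicTransversal ((fun x => (φ x : V)) '' S) := by
  rw [← Function.comp_def, Set.image_comp]
  refine h.isGeodesicTransversal_image ((isVertexCover_image_iso φ).2 hS) fun s hs => ?_
  obtain ⟨x, rfl⟩ := φ.surjective s
  refine ⟨x, by_contra fun hx => ?_, rfl⟩
  have hfin : (leavesAt H (φ x)).Finite := (h.finite_neighborSet _).subset fun _ ho => ho.1
  have hone : 1 < (leavesAt H (φ x)).ncard :=
    Set.one_lt_ncard_iff_nontrivial_and_finite.2 ⟨hs, hfin⟩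
  have hsum := h.ncard_leavesAt_add_ncard_neighborSet φ x
  have := hdeg x hx
  omega

theorem exists_isMaximalGeodesic_of_mem (h : IsSiliconSet H Si) (hMS : IsKonigCover M S)
    (hcovered : ∀ x ∈ M.verts, (G.neighborSet x).ncard = 3)
    (huncovered : ∀ x ∉ M.verts, (G.neighborSet x).ncard = 2) {x : W} (hx : x ∈ S) :
    ∃ P : H.Subgraph, H.IsMaximalGeodesic P ∧
      P.verts ⊆ exclusiveVertices H Si (φ '' IsKonigCover.block M S x) := by
  have hsum := h.ncard_leavesAt_add_ncard_neighborSet φ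
  by_cases hxM : x ∈ M.verts
  · obtain ⟨y, hxy, -⟩ := hMS.isMatching hxM
    have hleaf {z : W} (hz : z ∈ M.verts) : (leavesAt H (φ z)).Nonempty :=
      Set.nonempty_of_ncard_ne_zero (by have := hsum z; have := hcovered z hz; omega)
    obtain ⟨P, hP, hsub⟩ := h.exists_isMaximalGeodesic_of_adj (φ.map_adj_iff.2 hxy.adj_sub)
      (hleaf hxM) (hleaf hxy.snd_mem)
    refine ⟨P, hP, hsub.trans (exclusiveVertices_mono ?_)⟩
    exact Set.insert_subset ⟨x, .inl rfl, rfl⟩ <| Set.singleton_subset_iff.2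
      ⟨y, .inr ⟨hMS.notMem_of_adj hxy hx, hxy⟩, rfl⟩
  · have hleaves : 1 < (leavesAt H (φ x)).ncard := by
      have := hsum x
      have := huncovered x hxM
      omega
    obtain ⟨P, hP, hsub⟩ := h.exists_isMaximalGeodesic_of_nontrivial
      (Set.one_lt_ncard_iff_nontrivial_and_finite.1 hleaves).1
    exact ⟨P, hP, hsub.trans (exclusiveVertices_mono
      (Set.singleton_subset_iff.2 ⟨x, .inl rfl, rfl⟩))⟩

theorem gpack_eq_ncard_and_gt_eq_ncard [Finite V] (h : IsSiliconSet H Si)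
    (φ : G ≃g siliconGraph H Si) (hMS : IsKonigCover M S)
    (hcovered : ∀ x ∈ M.verts, (G.neighborSet x).ncard = 3)
    (huncovered : ∀ x ∉ M.verts, (G.neighborSet x).ncard = 2) :
    H.gpack = S.ncard ∧ H.gt = S.ncard := by
  choose P hP hsub using fun x : S =>
    h.exists_isMaximalGeodesic_of_mem φ hMS hcovered huncovered x.2
  obtain ⟨F, hF, hFcard⟩ := exists_isGeodesicPacking_ncard_eq hP fun x y hxy =>
    (h.disjoint_exclusiveVertices <| (Set.disjoint_image_iff φ.injective).2 <|
      hMS.disjoint_block x.2 y.2 (Subtype.coe_ne_coe.2 hxy)).mono (hsub x) (hsub y)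
  have hT := h.isGeodesicTransversal_of_isVertexCover φ hMS.isVertexCover
    fun x hx => hcovered x (hMS.mem_verts hx)
  have hTcard := Set.ncard_image_of_injective S (Subtype.val_injective.comp φ.injective)
  rw [← hTcard]
  exact gpack_eq_and_gt_eq_of_ncard_eq hF hT (hFcard.trans hTcard.symm)

theorem ncard_neighborSet_ne_two (h : IsSiliconSet H Si) {s : V} (hs : s ∈ Si) :
    (H.neighborSet s).ncard ≠ 2 := by
  rw [h.ncard_eq_four s hs]
  norm_num

theorem ncard_neighborSet_eq_one (h : IsSiliconSet H Si) {o : V} (ho : o ∉ Si)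
    (h2 : (H.neighborSet o).ncard ≠ 2) : (H.neighborSet o).ncard = 1 := by
  have := h.one_le_ncard o ho
  have := h.ncard_le_two o ho
  omega

theorem siliconGraph_adj_of_adj_adj (h : IsSiliconSet H Si) {x y o : V} (hne : x ≠ y)
    (ho : (H.neighborSet o).ncard = 2) (hxo : H.Adj x o) (hoy : H.Adj o y) :
    ∃ (hx : x ∈ Si) (hy : y ∈ Si), (siliconGraph H Si).Adj ⟨x, hx⟩ ⟨y, hy⟩ :=
  have hoO : o ∉ Si := fun hs => h.ncard_neighborSet_ne_two hs ho
  ⟨h.mem_of_adj hoO hxo.symm, h.mem_of_adj hoO hoy, fun he => hne (congrArg Subtype.val he),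
    o, hxo, hoy.symm⟩

theorem smooth_adj_of_siliconGraph_adj (h : IsSiliconSet H Si) {s t : Si}
    (hst : (siliconGraph H Si).Adj s t) :
    H.smooth.Adj ⟨s, h.ncard_neighborSet_ne_two s.2⟩ ⟨t, h.ncard_neighborSet_ne_two t.2⟩ := by
  have hne : (s : V) ≠ t := Subtype.coe_ne_coe.2 hst.1
  obtain ⟨o, hso : H.Adj s o, hto : H.Adj t o⟩ := hst.2
  have ho : (H.neighborSet o).ncard = 2 := by
    rw [h.neighborSet_eq_pair (h.notMem_of_adj s.2 hso) hso.symm hto.symm hne, Set.ncard_pair hne]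
  refine ⟨fun he => hne (congrArg (fun x => x.1) he), .cons hso (.cons hto.symm .nil), ?_, ?_⟩
  · simp [Walk.cons_isPath_iff, hso.ne, hto.ne', hne]
  · intro v hv hvs hvt
    simp only [Walk.support_cons, Walk.support_nil, List.mem_cons, List.not_mem_nil, hvs, hvt,
      or_false, false_or] at hv
    rwa [hv]

theorem smooth_adj_iff (h : IsSiliconSet H Si) {x y : {v : V // (H.neighborSet v).ncard ≠ 2}} :
    H.smooth.Adj x y ↔ H.Adj x y ∨
      ∃ (hx : x.1 ∈ Si) (hy : y.1 ∈ Si), (siliconGraph H Si).Adj ⟨x, hx⟩ ⟨y, hy⟩ := by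
  refine ⟨?_, ?_⟩
  · rintro ⟨hne, p, hp, hdeg⟩
    have hne : x.1 ≠ y.1 := Subtype.coe_ne_coe.2 hne
    generalize x.1 = u, y.1 = w at hne p hp hdeg
    match p with
    | .nil => exact absurd rfl hne
    | .cons huw .nil => exact .inl huw
    | .cons huo (.cons how .nil) =>
      exact .inr (h.siliconGraph_adj_of_adj_adj hne (hdeg _ (by simp) huo.ne' how.ne) huo how)
    | .cons (v := a) hua (.cons (v := b) hab (.cons hbc q)) =>
      -- Two consecutive atoms are not both oxygen.
      have hw := q.end_mem_support
      simp only [Walk.cons_isPath_iff, Walk.support_cons, List.mem_cons, not_or] at hp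
      have ha := hdeg a (by simp) (Ne.symm hp.2.1) fun he => hp.1.2.2 (he ▸ hw)
      have hb := hdeg b (by simp) (Ne.symm hp.2.2.1) fun he => hp.1.1.2 (he ▸ hw)
      have haO : a ∉ Si := fun hs => h.ncard_neighborSet_ne_two hs ha
      exact absurd hb (h.ncard_neighborSet_ne_two (h.mem_of_adj haO hab))
  · rintro (hxy | ⟨hx, hy, hxy⟩)
    · refine ⟨fun he => hxy.ne (congrArg Subtype.val he), .cons hxy .nil, by simp [hxy.ne], ?_⟩
      intro v hv hvx hvy
      simp [hvx, hvy] at hv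
    · exact h.smooth_adj_of_siliconGraph_adj hxy

theorem ncard_neighborSet_smooth_of_notMem (h : IsSiliconSet H Si)
    {x : {v : V // (H.neighborSet v).ncard ≠ 2}} (hx : x.1 ∉ Si) :
    (H.smooth.neighborSet x).ncard = 1 := by
  rw [← Set.ncard_image_of_injective _ Subtype.val_injective,
    ← h.ncard_neighborSet_eq_one hx x.2]
  congr 1
  ext s
  simp only [Set.mem_image, mem_neighborSet, h.smooth_adj_iff, hx, IsEmpty.exists_iff, or_false]
  refine ⟨?_, fun hs => ⟨⟨s, h.ncard_neighborSet_ne_two (h.mem_of_adj hx hs)⟩, hs, rfl⟩⟩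
  rintro ⟨s, hs, rfl⟩
  exact hs

theorem finite_neighborSet_siliconGraph (h : IsSiliconSet H Si) (s : Si) :
    ((siliconGraph H Si).neighborSet s).Finite := by
  refine Set.Finite.of_finite_image (f := Subtype.val) ?_ Subtype.val_injective.injOn
  refine ((h.finite_neighborSet s).biUnion fun o _ => h.finite_neighborSet o).subset ?_
  rintro _ ⟨t, ⟨-, o, hso, hto⟩, rfl⟩
  exact Set.mem_biUnion hso (H.adj_symm hto)

theorem ncard_neighborSet_smooth_of_mem (h : IsSiliconSet H Si)
    {x : {v : V // (H.neighborSet v).ncard ≠ 2}} (hx : x.1 ∈ Si) :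
    (H.smooth.neighborSet x).ncard = 4 := by
  have himage : Subtype.val '' H.smooth.neighborSet x =
      leavesAt H x ∪ Subtype.val '' (siliconGraph H Si).neighborSet ⟨x, hx⟩ := by
    ext v
    simp only [Set.mem_image, Set.mem_union, mem_neighborSet, h.smooth_adj_iff, leavesAt,
      Set.mem_ofPred_eq]
    refine ⟨?_, ?_⟩
    · rintro ⟨y, hxy | ⟨_, hy, hxy⟩, rfl⟩
      · exact .inl ⟨hxy, h.ncard_neighborSet_eq_one (h.notMem_of_adj hx hxy) y.2⟩
      · exact .inr ⟨_, hxy, rfl⟩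
    · rintro (⟨hxv, hv⟩ | ⟨t, hxt, rfl⟩)
      · exact ⟨⟨v, by omega⟩, .inl hxv, rfl⟩
      · exact ⟨⟨t, h.ncard_neighborSet_ne_two t.2⟩, .inr ⟨hx, t.2, hxt⟩, rfl⟩
  have hdisj : Disjoint (leavesAt H x) (Subtype.val '' (siliconGraph H Si).neighborSet ⟨x, hx⟩) :=
    Set.disjoint_left.2 fun o ho ⟨t, _, hto⟩ => h.notMem_of_adj hx ho.1 (hto ▸ t.2)
  rw [← Set.ncard_image_of_injective _ Subtype.val_injective, himage,
    Set.ncard_union_eq hdisj ((h.finite_neighborSet _).subset fun _ ho => ho.1)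
      ((h.finite_neighborSet_siliconGraph _).image _),
    Set.ncard_image_of_injective _ Subtype.val_injective]
  exact h.ncard_leavesAt_add_ncard_neighborSet_siliconGraph ⟨x, hx⟩

/-- The silicon atoms of `H` are the vertices of `SM(H)` that are not pendant. -/
def siliconGraphIso (h : IsSiliconSet H Si) : siliconGraph H Si ≃g H.smooth.deletePendants where
  toFun s := ⟨⟨s, h.ncard_neighborSet_ne_two s.2⟩, by
    rw [h.ncard_neighborSet_smooth_of_mem s.2]; norm_num⟩
  invFun x := ⟨x.1.1, by_contra fun hx => x.2 (h.ncard_neighborSet_smooth_of_notMem hx)⟩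
  left_inv _ := rfl
  right_inv _ := rfl
  map_rel_iff' {s t} := by
    refine h.smooth_adj_iff.trans ⟨?_, fun hst => .inr ⟨s.2, t.2, hst⟩⟩
    rintro (hst | ⟨_, _, hst⟩)
    · exact absurd t.2 (h.notMem_of_adj s.2 hst)
    · exact hst

theorem nonempty_smooth_iso_attachLeaves (h : IsSiliconSet H Si) (φ : G ≃g siliconGraph H Si)
    (hcovered : ∀ x ∈ M.verts, (G.neighborSet x).ncard = 3)
    (huncovered : ∀ x ∉ M.verts, (G.neighborSet x).ncard = 2) :
    Nonempty (H.smooth ≃g G.attachLeaves M) := by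
  let ψ : G ≃g H.smooth.deletePendants := φ.trans h.siliconGraphIso
  have hsum (x : W) : (leavesAt H.smooth (ψ x)).ncard + (G.neighborSet x).ncard = 4 := by
    have hdeg : (H.smooth.neighborSet (ψ x)).ncard = 4 := h.ncard_neighborSet_smooth_of_mem (φ x).2
    rw [← hdeg, ← ncard_leavesAt_add_ncard_neighborSet_deletePendants
      (Set.finite_of_ncard_pos (by omega)) (ψ x).2]
    exact congrArg _ (Nat.card_congr (ψ.mapNeighborSet x))
  refine nonempty_iso_attachLeaves (φ := ψ) (fun v w hv hvw hw => ?_) (fun x hx => ?_)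
    fun x hx => ?_
  · have hoxygen {u} (hu : (H.smooth.neighborSet u).ncard = 1) : u.1 ∉ Si := fun hs => by
      rw [h.ncard_neighborSet_smooth_of_mem hs] at hu
      norm_num at hu
    rcases h.smooth_adj_iff.1 hvw with hvw | ⟨hs, -⟩
    · exact hoxygen hw (h.mem_of_adj (hoxygen hv) hvw)
    · exact hoxygen hv hs
  · have := hsum x
    have := hcovered x hx
    omega
  · have := hsum x
    have := huncovered x hx
    omega

end IsSiliconSet

end Silicates

section Coordinates

variable {r : ℕ} {u v : Fin 3 → ℤ} {i j : Fin 3}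

theorem forall_fin_three_iff (i : Fin 3) {p : Fin 3 → Prop} :
    (∀ j, p j) ↔ p i ∧ p (i + 1) ∧ p (i + 2) := by
  rw [(Equiv.addLeft i).surjective.forall]
  simp [Fin.forall_fin_succ]

theorem sum_fin_three {A : Type*} [AddCommMonoid A] (i : Fin 3) (f : Fin 3 → A) :
    ∑ j, f j = f i + f (i + 1) + f (i + 2) := by
  rw [← Equiv.sum_comp (Equiv.addLeft i), Fin.sum_univ_three]
  simp

/-- `v` is a vertex of the hexagonal lattice, i.e. a corner of one of its hexagons. -/
def IsLatticePoint (v : Fin 3 → ℤ) : Prop :=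
  ∑ i, v i = 1 ∨ ∑ i, v i = 2

/-- `v` is a vertex of the hexagonal lattice in the `r`-layer nanosheet, described without reference
to the hexagons. -/
def IsSheetPoint (r : ℕ) (v : Fin 3 → ℤ) : Prop :=
  IsLatticePoint v ∧ ∀ i, 1 - (r : ℤ) ≤ v i ∧ v i ≤ r

/-- The other end of the edge of the hexagonal lattice at its vertex `v` in the direction of the
coordinate `i`: this coordinate is raised by `1` if the coordinate sum is `1` and lowered by `1` if
it is `2`. -/
def edgeFlip (i : Fin 3) (v : Fin 3 → ℤ) : Fin 3 → ℤ :=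
  Function.update v i (v i + (3 - 2 * ∑ j, v j))

@[simp]
theorem edgeFlip_apply_self : edgeFlip i v i = v i + (3 - 2 * ∑ j, v j) :=
  Function.update_self ..

@[simp]
theorem edgeFlip_apply_of_ne (h : j ≠ i) : edgeFlip i v j = v j :=
  Function.update_of_ne h ..

theorem sum_edgeFlip (i : Fin 3) (v : Fin 3 → ℤ) : ∑ j, edgeFlip i v j = 3 - ∑ j, v j := by
  rw [sum_fin_three i, sum_fin_three i v, edgeFlip_apply_self, edgeFlip_apply_of_ne (by simp),
    edgeFlip_apply_of_ne (by simp), sum_fin_three i v]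
  ring

theorem edgeFlip_edgeFlip (i : Fin 3) (v : Fin 3 → ℤ) : edgeFlip i (edgeFlip i v) = v := by
  ext j
  by_cases hj : j = i
  · subst hj
    rw [edgeFlip_apply_self, edgeFlip_apply_self, sum_edgeFlip]
    ring
  · simp [hj]

theorem isLatticePoint_edgeFlip (hv : IsLatticePoint v) (i : Fin 3) :
    IsLatticePoint (edgeFlip i v) := by
  unfold IsLatticePoint at *
  rw [sum_edgeFlip]
  omega

theorem edgeFlip_left_injective (v : Fin 3 → ℤ) : Function.Injective fun i => edgeFlip i v := by
  intro i j hij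
  by_contra hne
  have := congrFun (show edgeFlip i v = edgeFlip j v from hij) i
  rw [edgeFlip_apply_self, edgeFlip_apply_of_ne hne] at this
  omega

theorem sum_abs_sub_eq_one_iff (hu : IsLatticePoint u) (hv : IsLatticePoint v) :
    ∑ i, |u i - v i| = 1 ↔ ∃ i, v = edgeFlip i u := by
  unfold IsLatticePoint at hu hv
  refine ⟨fun h => ?_, ?_⟩
  · obtain ⟨i, hi⟩ : ∃ i, u i ≠ v i := by
      by_contra! heq
      simp [heq] at h
    refine ⟨i, funext <| (forall_fin_three_iff i).2 ?_⟩
    rw [edgeFlip_apply_self, edgeFlip_apply_of_ne (by simp), edgeFlip_apply_of_ne (by simp)]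
    simp only [sum_fin_three i] at *
    grind
  · rintro ⟨i, rfl⟩
    rw [sum_fin_three i, edgeFlip_apply_self, edgeFlip_apply_of_ne (by simp),
      edgeFlip_apply_of_ne (by simp)]
    rcases hu with hu | hu <;> simp [hu]

theorem isSheetPoint_edgeFlip_iff (hv : IsSheetPoint r v) :
    IsSheetPoint r (edgeFlip i v) ↔ (∑ j, v j = 1 → v i < r) ∧ (∑ j, v j = 2 → 1 - r < v i) := by
  have hsum := hv.1
  have hi := hv.2 i
  rw [IsSheetPoint, and_iff_right (isLatticePoint_edgeFlip hv.1 i)]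
  unfold IsLatticePoint at hsum
  refine ⟨fun h => ?_, fun h j => ?_⟩
  · have := h i
    rw [edgeFlip_apply_self] at this
    omega
  · by_cases hj : j = i
    · subst hj
      rw [edgeFlip_apply_self]
      omega
    · rw [edgeFlip_apply_of_ne hj]
      exact hv.2 j

theorem IsSheetPoint.exists_isSheetCentre (hu : IsSheetPoint r u)
    (hv : IsSheetPoint r (edgeFlip i u)) :
    ∃ c, IsSheetCentre r c ∧ IsHexagonCorner c u ∧ IsHexagonCorner c (edgeFlip i u) := by
  wlog hsum : ∑ j, u j = 1 generalizing u
  · have hu' := hu.1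
    obtain ⟨c, hc, hcv, hcu⟩ := this hv (by rwa [edgeFlip_edgeFlip])
      (by rw [sum_edgeFlip]; unfold IsLatticePoint at hu'; omega)
    exact ⟨c, hc, by rwa [edgeFlip_edgeFlip] at hcu, hcv⟩
  have hi := (isSheetPoint_edgeFlip_iff hu).1 hv
  have hbox := (forall_fin_three_iff i).1 hu.2
  -- The hexagons at this edge have the centres `u - Pi.single j 1` with `j ≠ i`.
  obtain ⟨j, hji, hj, hne⟩ : ∃ j ≠ i, 2 - r ≤ u j ∧ ∀ k ≠ j, u k < r := by
    rw [sum_fin_three i] at hsum hi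
    by_cases h : 2 - r ≤ u (i + 1) ∧ u (i + 2) < r
    · exact ⟨i + 1, by simp, h.1, (forall_fin_three_iff i).2 (by simp; omega)⟩
    · exact ⟨i + 2, by simp, by omega, (forall_fin_three_iff i).2 (by simp; omega)⟩
  refine ⟨u - Pi.single j 1, ⟨by simp [hsum], fun k => ?_⟩, ⟨fun k => ?_, hu.1⟩, fun k => ?_, hv.1⟩
  · have := hu.2 k
    have := hne k
    rw [Pi.sub_apply, abs_lt]
    by_cases hk : k = j
    · subst hk
      rw [Pi.single_eq_same]
      omega
    · rw [Pi.single_eq_of_ne hk]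
      omega
  · by_cases hk : k = j <;> simp [hk]
  · by_cases hk : k = j
    · simp [hk, hji]
    · by_cases hki : k = i <;> simp [hk, hki, hji.symm, hsum]

/-- The distance of the vertex `v` of the hexagonal lattice from the central hexagon: the sum of the
distances of its coordinates from `{0, 1}`. -/
def level (v : Fin 3 → ℤ) : ℤ :=
  ∑ i, max (v i - 1) (-v i)

theorem level_eq (i : Fin 3) (v : Fin 3 → ℤ) :
    level v = max (v i - 1) (-v i) + max (v (i + 1) - 1) (-v (i + 1)) +
      max (v (i + 2) - 1) (-v (i + 2)) :=
  sum_fin_three i _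

/-- The coordinate `i` is the only positive or the only nonpositive coordinate of `v`. -/
def IsApex (i : Fin 3) (v : Fin 3 → ℤ) : Prop :=
  ∀ j ≠ i, (0 < v j ↔ v i ≤ 0)

theorem isApex_iff : IsApex i v ↔ (0 < v (i + 1) ↔ v i ≤ 0) ∧ (0 < v (i + 2) ↔ v i ≤ 0) := by
  simp [IsApex, forall_fin_three_iff i]

theorem exists_isApex (hv : IsLatticePoint v) : ∃ i, IsApex i v := by
  by_contra! hnot
  have h0 := hnot 0
  have h1 := hnot 1
  have h2 := hnot 2
  simp only [isApex_iff, Fin.isValue, Fin.reduceAdd, zero_add] at h0 h1 h2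
  rw [IsLatticePoint, Fin.sum_univ_three] at hv
  omega

theorem IsApex.eq (hi : IsApex i v) (hj : IsApex j v) : i = j := by
  by_contra hne
  obtain ⟨k, hki, hkj⟩ := Fin.exists_ne_and_ne_of_two_lt i j (by norm_num)
  have := hi j (Ne.symm hne)
  have := hi k hki
  have := hj k hkj
  omega

theorem IsApex.edgeFlip (hv : IsLatticePoint v) (hi : IsApex i v) : IsApex i (edgeFlip i v) := by
  unfold IsLatticePoint at hv
  rw [isApex_iff] at *
  rw [edgeFlip_apply_self, edgeFlip_apply_of_ne (by simp), edgeFlip_apply_of_ne (by simp)]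
  rw [sum_fin_three i] at *
  omega

theorem IsApex.even_level_iff (hv : IsLatticePoint v) (hi : IsApex i v) :
    Even (level v) ↔ (0 < v i ↔ ∑ j, v j = 1) := by
  unfold IsLatticePoint at hv
  rw [isApex_iff] at hi
  rw [level_eq i, Int.even_iff]
  rw [sum_fin_three i] at *
  omega

theorem level_edgeFlip (i : Fin 3) (v : Fin 3 → ℤ) :
    level (edgeFlip i v) + max (v i - 1) (-v i) =
      level v + max (v i + 2 - 2 * ∑ j, v j) (2 * ∑ j, v j - v i - 3) := by
  rw [level_eq i, level_eq i v, edgeFlip_apply_self,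
    edgeFlip_apply_of_ne (by simp), edgeFlip_apply_of_ne (by simp)]
  omega

theorem isApex_iff_level_edgeFlip (hv : IsLatticePoint v) (heven : Even (level v)) :
    IsApex i v ↔ level (edgeFlip i v) = level v + 1 := by
  unfold IsLatticePoint at hv
  have hflip := level_edgeFlip i v
  rw [Int.even_iff, level_eq i v] at heven
  rw [level_eq i v] at hflip ⊢
  rw [isApex_iff]
  rw [sum_fin_three i] at *
  omega

theorem even_level_edgeFlip (hv : IsLatticePoint v) (hodd : ¬Even (level v)) (i : Fin 3) :
    Even (level (edgeFlip i v)) := by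
  have hflip := level_edgeFlip i v
  unfold IsLatticePoint at hv
  rw [level_eq i v] at hodd hflip
  rw [sum_fin_three i] at hflip hv
  rw [Int.even_iff] at *
  omega

theorem level_le (hv : IsSheetPoint r v) : level v ≤ 2 * (r - 1) := by
  obtain ⟨i, hi⟩ := exists_isApex hv.1
  rw [isApex_iff] at hi
  have hbox := hv.2 i
  have hsum := hv.1
  rw [IsLatticePoint, sum_fin_three i] at hsum
  rw [level_eq i]
  omega

theorem IsSheetPoint.edgeFlip_of_not_isApex (hv : IsSheetPoint r v) (hi : ¬IsApex i v) :
    IsSheetPoint r (edgeFlip i v) := by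
  have hbox := (forall_fin_three_iff i).1 hv.2
  rw [isSheetPoint_edgeFlip_iff hv, sum_fin_three i]
  rw [isApex_iff] at hi
  omega

theorem IsSheetPoint.edgeFlip_of_not_even_level (hv : IsSheetPoint r v)
    (hodd : ¬Even (level v)) (i : Fin 3) : IsSheetPoint r (edgeFlip i v) := by
  have hbox := (forall_fin_three_iff i).1 hv.2
  by_cases hi : IsApex i v
  · rw [hi.even_level_iff hv.1, sum_fin_three i] at hodd
    rw [isSheetPoint_edgeFlip_iff hv, sum_fin_three i]
    omega
  · exact hv.edgeFlip_of_not_isApex hi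

end Coordinates

section Nanosheet

variable {r : ℕ} {i : Fin 3}

theorem exists_isSheetCentre_iff {v : Fin 3 → ℤ} :
    (∃ c, IsSheetCentre r c ∧ IsHexagonCorner c v) ↔ IsSheetPoint r v := by
  refine ⟨?_, fun hv => ?_⟩
  · rintro ⟨c, hc, hv⟩
    refine ⟨hv.2, fun i => ?_⟩
    have := abs_lt.1 (hc.2 i)
    have := hv.1 i
    omega
  · obtain ⟨a, ha⟩ := exists_isApex hv.1
    have hnot : ¬IsApex (a + 1) v := fun ha' => absurd (ha.eq ha') (by simp)
    obtain ⟨c, hc, hcv, -⟩ := hv.exists_isSheetCentre (hv.edgeFlip_of_not_isApex hnot)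
    exact ⟨c, hc, hcv⟩

namespace NanosheetVertex

theorem isSheetPoint (u : NanosheetVertex r) : IsSheetPoint r u.1 :=
  exists_isSheetCentre_iff.1 u.2

theorem isLatticePoint (u : NanosheetVertex r) : IsLatticePoint u.1 :=
  u.isSheetPoint.1

end NanosheetVertex

theorem nanosheet_adj_iff {u v : NanosheetVertex r} :
    (nanosheet r).Adj u v ↔ ∃ i, v.1 = edgeFlip i u.1 := by
  rw [← sum_abs_sub_eq_one_iff u.isLatticePoint v.isLatticePoint]
  refine ⟨fun h => h.1, fun h => ⟨h, ?_⟩⟩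
  obtain ⟨i, hi⟩ := (sum_abs_sub_eq_one_iff u.isLatticePoint v.isLatticePoint).1 h
  rw [hi]
  exact u.isSheetPoint.exists_isSheetCentre (hi ▸ v.isSheetPoint)

theorem ncard_neighborSet_nanosheet (u : NanosheetVertex r) :
    ((nanosheet r).neighborSet u).ncard = {i | IsSheetPoint r (edgeFlip i u.1)}.ncard := by
  symm
  refine Set.ncard_congr
    (fun i hi => (⟨edgeFlip i u.1, exists_isSheetCentre_iff.2 hi⟩ : NanosheetVertex r))
    (fun i _ => nanosheet_adj_iff.2 ⟨i, rfl⟩)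
    (fun i j _ _ hij => edgeFlip_left_injective u.1 (congrArg (fun v => v.1) hij)) fun v hv => ?_
  obtain ⟨i, hi⟩ := nanosheet_adj_iff.1 hv
  have hflip : IsSheetPoint r (edgeFlip i u.1) := hi ▸ v.isSheetPoint
  exact ⟨i, hflip, Subtype.ext hi.symm⟩

theorem ncard_neighborSet_nanosheet_of_isSheetPoint {u : NanosheetVertex r} (hi : IsApex i u.1)
    (hflip : IsSheetPoint r (edgeFlip i u.1)) : ((nanosheet r).neighborSet u).ncard = 3 := by
  have huniv : {j | IsSheetPoint r (edgeFlip j u.1)} = Set.univ := by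
    refine Set.eq_univ_of_forall fun j => ?_
    rcases eq_or_ne j i with rfl | hj
    · exact hflip
    · exact u.isSheetPoint.edgeFlip_of_not_isApex fun hj' => hj (hj'.eq hi)
  rw [ncard_neighborSet_nanosheet, huniv, Set.ncard_univ, Nat.card_fin]

theorem ncard_neighborSet_nanosheet_of_not_isSheetPoint {u : NanosheetVertex r} (hi : IsApex i u.1)
    (hflip : ¬IsSheetPoint r (edgeFlip i u.1)) : ((nanosheet r).neighborSet u).ncard = 2 := by
  have hcompl : {j | IsSheetPoint r (edgeFlip j u.1)} = {i}ᶜ := by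
    ext j
    refine ⟨fun hj hji => hflip (hji ▸ hj), fun hj => ?_⟩
    exact u.isSheetPoint.edgeFlip_of_not_isApex fun hj' => hj (hj'.eq hi)
  rw [ncard_neighborSet_nanosheet, hcompl, Set.ncard_compl, Set.ncard_singleton, Nat.card_fin]

theorem exists_edgeFlip_sum_abs_sub_lt {u v : Fin 3 → ℤ} (hu : IsSheetPoint r u)
    (hv : IsSheetPoint r v) (hne : u ≠ v) : ∃ i, IsSheetPoint r (edgeFlip i u) ∧
      ∑ j, |edgeFlip i u j - v j| + 1 = ∑ j, |u j - v j| := by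
  have hstep (i : Fin 3) (hi : if ∑ j, u j = 1 then u i < v i else v i < u i) :
      IsSheetPoint r (edgeFlip i u) ∧
        ∑ j, |edgeFlip i u j - v j| + 1 = ∑ j, |u j - v j| := by
    have hbox := hv.2 i
    refine ⟨(isSheetPoint_edgeFlip_iff hu).2 (by split_ifs at hi <;> omega), ?_⟩
    rw [sum_fin_three i, sum_fin_three i fun j => |u j - v j|, edgeFlip_apply_self,
      edgeFlip_apply_of_ne (by simp), edgeFlip_apply_of_ne (by simp)]
    have hsum := hu.1
    unfold IsLatticePoint at hsum
    grind
  suffices ∃ i, if ∑ j, u j = 1 then u i < v i else v i < u i from this.imp hstep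
  by_contra! hnot
  refine hne (funext fun i => ?_)
  have hboth := (forall_fin_three_iff i).1 hnot
  have hsumu := hu.1
  have hsumv := hv.1
  rw [IsLatticePoint, sum_fin_three i] at hsumu hsumv
  rw [sum_fin_three i] at hboth
  split_ifs at hboth <;> omega

theorem exists_walk_length_eq (u v : NanosheetVertex r) :
    ∃ p : (nanosheet r).Walk u v, (p.length : ℤ) = ∑ i, |u.1 i - v.1 i| := by
  generalize hn : ∑ i, |u.1 i - v.1 i| = n
  have hn0 : 0 ≤ n := hn ▸ Finset.sum_nonneg fun i _ => abs_nonneg _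
  lift n to ℕ using hn0
  induction n generalizing u with
  | zero =>
    obtain rfl : u = v := Subtype.ext <| funext fun i => sub_eq_zero.1 <| abs_eq_zero.1 <|
      (Finset.sum_eq_zero_iff_of_nonneg fun i _ => abs_nonneg _).1 hn i (Finset.mem_univ i)
    exact ⟨.nil, rfl⟩
  | succ n ih =>
    have hne : u.1 ≠ v.1 := by
      intro heq
      simp only [heq, sub_self, abs_zero, Finset.sum_const_zero] at hn
      omega
    obtain ⟨i, hflip, hdecr⟩ := exists_edgeFlip_sum_abs_sub_lt u.isSheetPoint v.isSheetPoint hne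
    let w : NanosheetVertex r := ⟨edgeFlip i u.1, exists_isSheetCentre_iff.2 hflip⟩
    obtain ⟨p, hp⟩ := ih w (by rw [hn] at hdecr; push_cast at hdecr; exact add_right_cancel hdecr)
    exact ⟨.cons (nanosheet_adj_iff.2 ⟨i, rfl⟩) p, by rw [Walk.length_cons]; omega⟩

theorem sum_abs_sub_le_length {u v : NanosheetVertex r} (p : (nanosheet r).Walk u v) :
    ∑ i, |u.1 i - v.1 i| ≤ p.length := by
  induction p with
  | nil => simp
  | @cons u v w huv p ih =>
    have htri : ∑ i, |u.1 i - w.1 i| ≤ ∑ i, (|u.1 i - v.1 i| + |v.1 i - w.1 i|) :=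
      Finset.sum_le_sum fun i _ => abs_sub_le _ _ _
    rw [Finset.sum_add_distrib, huv.1] at htri
    rw [Walk.length_cons]
    push_cast
    omega

theorem dist_nanosheet (u v : NanosheetVertex r) :
    ((nanosheet r).dist u v : ℤ) = ∑ i, |u.1 i - v.1 i| := by
  obtain ⟨p, hp⟩ := exists_walk_length_eq u v
  obtain ⟨q, hq⟩ := p.reachable.exists_walk_length_eq_dist
  have := (nanosheet r).dist_le p
  have := sum_abs_sub_le_length q
  omega

theorem level_le_dist {u c : NanosheetVertex r} (hc : c ∈ centralHexagon r) :
    level u.1 ≤ (nanosheet r).dist u c := by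
  rw [dist_nanosheet]
  refine Finset.sum_le_sum fun i _ => ?_
  have hci := hc.1 i
  rw [Pi.zero_apply] at hci
  have := le_abs_self (u.1 i - c.1 i)
  have := neg_le_abs (u.1 i - c.1 i)
  omega

theorem exists_mem_centralHexagon_dist_eq (u : NanosheetVertex r) :
    ∃ c ∈ centralHexagon r, ((nanosheet r).dist u c : ℤ) = level u.1 := by
  let c : Fin 3 → ℤ := fun i => if 0 < u.1 i then 1 else 0
  have hsum : IsLatticePoint c := by
    have hsum := u.isLatticePoint
    rw [IsLatticePoint, Fin.sum_univ_three] at *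
    grind
  have hc : IsSheetPoint r c := ⟨hsum, fun i => by have := u.isSheetPoint.2 i; grind⟩
  let w : NanosheetVertex r := ⟨c, exists_isSheetCentre_iff.2 hc⟩
  refine ⟨w, ⟨fun i => ?_, hsum⟩, (dist_nanosheet u w).trans <| Finset.sum_congr rfl fun i _ => ?_⟩
  · rw [Pi.zero_apply]
    grind
  · grind

theorem distToSet_centralHexagon (u : NanosheetVertex r) :
    ((nanosheet r).distToSet u (centralHexagon r) : ℤ) = level u.1 := by
  obtain ⟨c, hc, hdist⟩ := exists_mem_centralHexagon_dist_eq u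
  rw [← hdist, Nat.cast_inj]
  refine IsLeast.csInf_eq ⟨⟨c, hc, rfl⟩, ?_⟩
  rintro _ ⟨c', hc', rfl⟩
  rw [← Nat.cast_le (α := ℤ), hdist]
  exact level_le_dist hc'

theorem isLayerStep_iff_of_eq_edgeFlip {u v : NanosheetVertex r} (hv : v.1 = edgeFlip i u.1) :
    IsLayerStep r u v ↔ Even (level u.1) ∧ IsApex i u.1 := by
  have hdu := distToSet_centralHexagon u
  have hdv := distToSet_centralHexagon v
  have hle := level_le u.isSheetPoint
  refine ⟨fun ⟨k, _, hku, hkv⟩ => ?_, fun ⟨heven, hi⟩ => ?_⟩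
  · have heven : Even (level u.1) := Int.even_iff.2 (by omega)
    exact ⟨heven, (isApex_iff_level_edgeFlip u.isLatticePoint heven).2 (by rw [← hv]; omega)⟩
  · have hstep := (isApex_iff_level_edgeFlip u.isLatticePoint heven).1 hi
    rw [← hv] at hstep
    rw [Int.even_iff] at heven
    exact ⟨(level u.1 / 2).toNat, by omega, by omega, by omega⟩

theorem layeredMatching_adj_iff {u v : NanosheetVertex r} :
    (layeredMatching r).Adj u v ↔ ∃ i, IsApex i u.1 ∧ v.1 = edgeFlip i u.1 := by
  have hsymm {i : Fin 3} (hv : v.1 = edgeFlip i u.1) : u.1 = edgeFlip i v.1 := by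
    rw [hv, edgeFlip_edgeFlip]
  refine ⟨fun ⟨hadj, hstep⟩ => ?_, fun ⟨i, hi, hv⟩ => ⟨nanosheet_adj_iff.2 ⟨i, hv⟩, ?_⟩⟩
  · obtain ⟨i, hv⟩ := nanosheet_adj_iff.1 hadj
    refine ⟨i, ?_, hv⟩
    rcases hstep with hstep | hstep
    · exact ((isLayerStep_iff_of_eq_edgeFlip hv).1 hstep).2
    · rw [hsymm hv]
      exact ((isLayerStep_iff_of_eq_edgeFlip (hsymm hv)).1 hstep).2.edgeFlip v.isLatticePoint
  · rw [isLayerStep_iff_of_eq_edgeFlip hv, isLayerStep_iff_of_eq_edgeFlip (hsymm hv), hv]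
    by_cases heven : Even (level u.1)
    · exact .inl ⟨heven, hi⟩
    · exact .inr ⟨even_level_edgeFlip u.isLatticePoint heven i, hi.edgeFlip u.isLatticePoint⟩

theorem mem_verts_layeredMatching_iff {u : NanosheetVertex r} (hi : IsApex i u.1) :
    u ∈ (layeredMatching r).verts ↔ IsSheetPoint r (edgeFlip i u.1) := by
  refine ⟨fun ⟨v, hv⟩ => ?_, fun hflip => ?_⟩
  · obtain ⟨j, hj, hv⟩ := layeredMatching_adj_iff.1 hv
    rw [hi.eq hj, ← hv]
    exact v.isSheetPoint
  · exact ⟨⟨_, exists_isSheetCentre_iff.2 hflip⟩, layeredMatching_adj_iff.2 ⟨i, hi, rfl⟩⟩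

theorem ncard_neighborSet_nanosheet_of_mem_verts {u : NanosheetVertex r}
    (hu : u ∈ (layeredMatching r).verts) : ((nanosheet r).neighborSet u).ncard = 3 := by
  obtain ⟨i, hi⟩ := exists_isApex u.isLatticePoint
  exact ncard_neighborSet_nanosheet_of_isSheetPoint hi ((mem_verts_layeredMatching_iff hi).1 hu)

theorem ncard_neighborSet_nanosheet_of_notMem_verts {u : NanosheetVertex r}
    (hu : u ∉ (layeredMatching r).verts) : ((nanosheet r).neighborSet u).ncard = 2 := by
  obtain ⟨i, hi⟩ := exists_isApex u.isLatticePoint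
  exact ncard_neighborSet_nanosheet_of_not_isSheetPoint hi
    (mt (mem_verts_layeredMatching_iff hi).2 hu)

theorem isKonigCover_layeredMatching (r : ℕ) :
    IsKonigCover (layeredMatching r) {u | Even (level u.1)} where
  isMatching u hu := by
    obtain ⟨v, hv : (layeredMatching r).Adj u v⟩ := hu
    refine ⟨v, hv, fun w hw => ?_⟩
    obtain ⟨i, hi, hv⟩ := layeredMatching_adj_iff.1 hv
    obtain ⟨j, hj, hw⟩ := layeredMatching_adj_iff.1 hw
    obtain rfl := hi.eq hj
    exact Subtype.ext (hw.trans hv.symm)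
  isVertexCover u v huv := by
    obtain ⟨i, hv⟩ := nanosheet_adj_iff.1 huv
    refine or_iff_not_imp_left.2 fun hu => ?_
    rw [Set.mem_ofPred_eq, hv]
    exact even_level_edgeFlip u.isLatticePoint hu i
  notMem_of_adj {u v} huv hu := by
    obtain ⟨i, hi, hv⟩ := layeredMatching_adj_iff.1 huv
    rw [Set.mem_ofPred_eq, hv, (isApex_iff_level_edgeFlip u.isLatticePoint hu).1 hi,
      Int.even_add_one, not_not]
    exact hu
  mem_verts {u} hu := by
    obtain ⟨i, hi⟩ := exists_isApex u.isLatticePoint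
    exact (mem_verts_layeredMatching_iff hi).2 (u.isSheetPoint.edgeFlip_of_not_even_level hu i)

end Nanosheet

section Counting

variable {r ε : ℕ} {i : Fin 3}

theorem two_mul_ncard_add_lt (n : ℕ) : 2 * {p : ℕ × ℕ | p.1 + p.2 < n}.ncard = n * (n + 1) := by
  induction n with
  | zero => simp
  | succ n ih =>
    have hunion : {p : ℕ × ℕ | p.1 + p.2 < n + 1} =
        {p | p.1 + p.2 < n} ∪ Finset.HasAntidiagonal.antidiagonal n := by
      ext p
      simp [le_iff_lt_or_eq]
    have hfin : {p : ℕ × ℕ | p.1 + p.2 < n}.Finite :=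
      ((Set.finite_Iio n).prod (Set.finite_Iio n)).subset fun p hp =>
        ⟨(Nat.le_add_right ..).trans_lt hp, (Nat.le_add_left ..).trans_lt hp⟩
    have hdisj : Disjoint {p : ℕ × ℕ | p.1 + p.2 < n} ↑(Finset.HasAntidiagonal.antidiagonal n) :=
      Set.disjoint_left.2 fun p hp hp' => hp.ne (Finset.HasAntidiagonal.mem_antidiagonal.1 hp')
    rw [hunion, Set.ncard_union_eq hdisj hfin, Set.ncard_coe_finset, Finset.Nat.card_antidiagonal,
      mul_add, ih]
    ring

/-- The vertex of the hexagonal lattice of level `ε + 2 * (p + q)` whose apex is the coordinate `i`,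
for `x = (i, b, p, q)`: the coordinate `i` is positive if `b` holds and nonpositive otherwise, and
`p` and `q` are the distances of the other two coordinates from `{0, 1}`. -/
def apexPoint (ε : ℕ) (x : Fin 3 × Bool × ℕ × ℕ) : Fin 3 → ℤ := fun j =>
  if j = x.1 then bif x.2.1 then 1 + ε + x.2.2.1 + x.2.2.2 else -ε - x.2.2.1 - x.2.2.2
  else if j = x.1 + 1 then bif x.2.1 then -x.2.2.1 else 1 + x.2.2.1
  else bif x.2.1 then -x.2.2.2 else 1 + x.2.2.2

theorem eq_apexPoint_true_iff {v : Fin 3 → ℤ} {p q : ℕ} : v = apexPoint ε (i, true, p, q) ↔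
    v i = 1 + ε + p + q ∧ v (i + 1) = -p ∧ v (i + 2) = -q := by
  simp [apexPoint, funext_iff, forall_fin_three_iff i]

theorem eq_apexPoint_false_iff {v : Fin 3 → ℤ} {p q : ℕ} : v = apexPoint ε (i, false, p, q) ↔
    v i = -ε - p - q ∧ v (i + 1) = 1 + p ∧ v (i + 2) = 1 + q := by
  simp [apexPoint, funext_iff, forall_fin_three_iff i]

theorem isApex_of_eq_apexPoint {v : Fin 3 → ℤ} {b : Bool} {p q : ℕ}
    (hv : v = apexPoint ε (i, b, p, q)) : IsApex i v := by
  rw [isApex_iff]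
  cases b
  · rw [eq_apexPoint_false_iff] at hv
    omega
  · rw [eq_apexPoint_true_iff] at hv
    omega

theorem apexPoint_injective (ε : ℕ) : Function.Injective (apexPoint ε) := by
  rintro ⟨i, b, p, q⟩ ⟨i', b', p', q'⟩ hv'
  generalize hv : apexPoint ε (i, b, p, q) = v at hv'
  replace hv := hv.symm
  obtain rfl : i = i' := (isApex_of_eq_apexPoint hv).eq (isApex_of_eq_apexPoint hv')
  cases b <;> cases b' <;>
    simp only [eq_apexPoint_true_iff, eq_apexPoint_false_iff] at hv hv' <;>
    grind

theorem image_apexPoint (r : ℕ) (hε : ε < 2) :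
    apexPoint ε '' {x | x.2.2.1 + x.2.2.2 < r - ε} =
      {v | IsSheetPoint r v ∧ level v % 2 = ε} := by
  ext v
  constructor
  · rintro ⟨⟨i, _ | _, p, q⟩, hx : p + q < r - ε, hv⟩
    · rw [eq_comm, eq_apexPoint_false_iff] at hv
      refine ⟨⟨?_, (forall_fin_three_iff i).2 (by omega)⟩, by rw [level_eq i]; omega⟩
      rw [IsLatticePoint, sum_fin_three i]
      omega
    · rw [eq_comm, eq_apexPoint_true_iff] at hv
      refine ⟨⟨?_, (forall_fin_three_iff i).2 (by omega)⟩, by rw [level_eq i]; omega⟩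
      rw [IsLatticePoint, sum_fin_three i]
      omega
  · rintro ⟨⟨hsum, hbox⟩, hlevel⟩
    obtain ⟨i, hi⟩ := exists_isApex hsum
    have := hbox i
    rw [IsLatticePoint, sum_fin_three i] at hsum
    rw [isApex_iff] at hi
    rw [level_eq i] at hlevel
    by_cases hpos : 0 < v i
    · refine ⟨(i, true, (-v (i + 1)).toNat, (-v (i + 2)).toNat), ?_, ?_⟩
      · change (-v (i + 1)).toNat + (-v (i + 2)).toNat < r - ε
        omega
      · rw [eq_comm, eq_apexPoint_true_iff]
        omega
    · refine ⟨(i, false, (v (i + 1) - 1).toNat, (v (i + 2) - 1).toNat), ?_, ?_⟩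
      · change (v (i + 1) - 1).toNat + (v (i + 2) - 1).toNat < r - ε
        omega
      · rw [eq_comm, eq_apexPoint_false_iff]
        omega

theorem ncard_level_emod_two (r : ℕ) (hε : ε < 2) :
    {u : NanosheetVertex r | level u.1 % 2 = ε}.ncard = 3 * ((r - ε) * (r - ε + 1)) := by
  have hprod : {x : Fin 3 × Bool × ℕ × ℕ | x.2.2.1 + x.2.2.2 < r - ε} =
      Set.univ ×ˢ Set.univ ×ˢ {p | p.1 + p.2 < r - ε} := by
    ext x
    simp
  calc {u : NanosheetVertex r | level u.1 % 2 = ε}.ncard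
      = {v | IsSheetPoint r v ∧ level v % 2 = ε}.ncard :=
        Set.ncard_congr (fun u _ => u.1) (fun u hu => ⟨u.isSheetPoint, hu⟩)
          (fun _ _ _ _ => Subtype.ext) fun v hv =>
            ⟨⟨v, exists_isSheetCentre_iff.2 hv.1⟩, hv.2, rfl⟩
    _ = 3 * (2 * {p : ℕ × ℕ | p.1 + p.2 < r - ε}.ncard) := by
      rw [← image_apexPoint r hε, Set.ncard_image_of_injective _ (apexPoint_injective ε), hprod,
        Set.ncard_prod, Set.ncard_prod, Set.ncard_univ, Set.ncard_univ, Nat.card_fin,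
        Nat.card_eq_fintype_card, Fintype.card_bool]
    _ = 3 * ((r - ε) * (r - ε + 1)) := by rw [two_mul_ncard_add_lt]

instance NanosheetVertex.finite (r : ℕ) : Finite (NanosheetVertex r) :=
  Finite.of_injective
    (fun u => (⟨u.1, fun i => (u.isSheetPoint.2 i).1, fun i => (u.isSheetPoint.2 i).2⟩ :
      Set.Icc (fun _ : Fin 3 => 1 - (r : ℤ)) fun _ => (r : ℤ)))
    fun _ _ huv => Subtype.ext (congrArg (fun v => v.1) huv)

theorem ncard_even_level (r : ℕ) :
    {u : NanosheetVertex r | Even (level u.1)}.ncard = 3 * (r ^ 2 + r) := by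
  simp_rw [Int.even_iff]
  exact (ncard_level_emod_two r two_pos).trans (by rw [Nat.sub_zero]; ring)

theorem card_nanosheetVertex (r : ℕ) : Nat.card (NanosheetVertex r) = 6 * r ^ 2 := by
  have hodd : {u : NanosheetVertex r | Even (level u.1)}ᶜ = {u | level u.1 % 2 = (1 : ℕ)} := by
    ext u
    simp [Int.odd_iff]
  rw [← Set.ncard_add_ncard_compl {u : NanosheetVertex r | Even (level u.1)}, ncard_even_level,
    hodd, ncard_level_emod_two r one_lt_two]
  cases r with
  | zero => rfl
  | succ n => rw [Nat.add_sub_cancel]; ring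

end Counting

theorem theorem5p2 {V : Type*} [Finite V] (r : ℕ) (hr : 1 ≤ r) (H : SimpleGraph V)
    (hH : IsHexagonalSilicateSheet r H) :
    H.gpack = H.gt ∧
    (layeredMatching r).IsMatching ∧
    Nonempty (H.smooth ≃g (nanosheet r).attachLeaves (layeredMatching r)) ∧
    Nat.card (NanosheetVertex r) = 6 * r ^ 2 ∧
    ((layeredMatching r).edgeSet.ncard : ℤ) = 3 * ((r : ℤ) ^ 2 - r) ∧
    (H.gt : ℤ) = Nat.card (NanosheetVertex r) - (layeredMatching r).edgeSet.ncard ∧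
    (H.gt : ℤ) = 6 * (r : ℤ) ^ 2 - 3 * ((r : ℤ) ^ 2 - r) ∧
    H.gt = 3 * (r ^ 2 + r) := by
  obtain ⟨hsilicate, ⟨e⟩⟩ := hH
  obtain ⟨Si, hSi⟩ := hsilicate.exists_isSiliconSet
  let φ : nanosheet r ≃g siliconGraph H Si := (hSi.siliconGraphIso.trans e).symm
  have hcover := isKonigCover_layeredMatching r
  have hcovered : ∀ u ∈ (layeredMatching r).verts, ((nanosheet r).neighborSet u).ncard = 3 :=
    fun _ => ncard_neighborSet_nanosheet_of_mem_verts
  have huncovered : ∀ u ∉ (layeredMatching r).verts, ((nanosheet r).neighborSet u).ncard = 2 :=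
    fun _ => ncard_neighborSet_nanosheet_of_notMem_verts
  obtain ⟨hgpack, hgt⟩ := hSi.gpack_eq_ncard_and_gt_eq_ncard φ hcover hcovered huncovered
  have hV := card_nanosheetVertex r
  have hM := hcover.ncard_add_ncard_edgeSet
  rw [ncard_even_level] at hgpack hgt hM
  refine ⟨hgpack.trans hgt.symm, hcover.isMatching,
    hSi.nonempty_smooth_iso_attachLeaves φ hcovered huncovered, hV, ?_, ?_, ?_, hgt⟩ <;>
  · zify at hV hM hgt
    linarith
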